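/- **DGG Lemma on graphs.** Let $V$ be a countable set, let $\mu:V\times V\to[0,\infty)$, $(x,y)\mapsto\mu_{xy}$, be symmetric with $\sum_{y\in V}\mu_{xy}<\infty$ for all $x\in V$, and let $m:V\to(0,\infty)$; write $x\sim y$ if $\mu_{xy}>0$ and $m(A)=\sum_{x\in A}m_x\in[0,\infty]$ for $A\subset V$. Let $\ell^2_m$ be the Hilbert space of real functions on $V$ with $\langle f,g\rangle=\sum_{x}f(x)g(x)m_x$. Let $Q$ be the closed quadratic form on $\ell^2_m$ whose domain $D(Q)$ is the closure of the finitely supported functions with respect to the $\ell^2_m$-norm together with the energy $\widetilde Q(f)=\frac12\sum_{x,y}\mu_{xy}|f(x)-f(y)|^2$, with $Q=\widetilde Q$ on $D(Q)$. Let $\Delta$ be its generator, that is, $f\in D(\Delta)$ and $\Delta f=h$ if and only if $f\in D(Q)$ and $Q(f,g)=-\langle h,g\rangle$ for all $g\in D(Q)$. Let $\lambda=\inf\sigma(-\Delta)$ be the bottom of the $\ell^2$-spectrum of the Laplacian, and let $p_t(x,y)=\frac{1}{m_xm_y}\langle e^{t\Delta}\mathbf 1_{\{x\}},\mathbf 1_{\{y\}}\rangle$,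 $t>0$, be the minimal heat kernel, i.e. the kernel with respect to $m$ of the semigroup $e^{t\Delta}$. Let $\rho:V\times V\to[0,\infty)$ be an intrinsic metric: $\rho$ is symmetric, vanishes on the diagonal, satisfies the triangle inequality, and $\sum_{y\in V}\mu_{xy}\rho(x,y)^2\le m_x$ for all $x\in V$. Assume that its jump size $s=\sup\{\rho(x,y): x\sim y\}$ satisfies $0<s<\infty$. For $t>0$ and $r\ge0$ put $$\zeta_s(t,r)=\frac1{s^2}\left(rs\,\operatorname{arsinh}\frac{rs}{t}-\sqrt{t^2+r^2s^2}+t\right).$$ Then for all subsets $A,B\subset V$ and all $t>0$, $$\sum_{y\in B}\sum_{x\in A}m_xm_y\,p_t(x,y)\le\sqrt{m(A)m(B)}\;e^{-\lambda t-\zeta_s(t,\rho(A,B))},$$ where $\rho(A,B)=\inf\{\rho(x,y):x\in A,\ y\in B\}$. Both sides are taken in $[0,\infty]$; if $A$ or $B$ is empty, both sides are $0$. -/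

import Mathlib

open MeasureTheory Filter Topology
open scoped ENNReal RealInnerProductSpace

/-- A weighted graph `(V, μ, m)`: `weight x y` is the edge weight `μ_{xy} ∈ [0, ∞)` and `m x > 0` is
the mass of the vertex `x`. Vertices `x`, `y` are neighbours when `0 < weight x y`; self-loops and
vertices with infinitely many neighbours are allowed. -/
structure WeightedGraph (V : Type*) where
  weight : V → V → ℝ
  weight_nonneg : ∀ x y, 0 ≤ weight x y
  weight_symm : ∀ x y, weight x y = weight y x
  weight_summable : ∀ x, Summable fun y => weight x y
  m : V → ℝ
  m_pos : ∀ x, 0 < m x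

namespace WeightedGraph

noncomputable section

variable {V : Type*}

/-! ### Intrinsic metrics -/

/-- A pseudo metric on `V`: symmetric, zero on the diagonal, with values in `[0, ∞)`, satisfying the
triangle inequality. -/
structure IsPseudoMetric (ρ : V → V → ℝ) : Prop where
  nonneg : ∀ x y, 0 ≤ ρ x y
  symm : ∀ x y, ρ x y = ρ y x
  diag : ∀ x, ρ x x = 0
  triangle : ∀ x y z, ρ x z ≤ ρ x y + ρ y z

/-- A pseudo metric is intrinsic if `∑_y μ_{xy} ρ(x,y)² ≤ m_x` for every `x`
(the sum is taken in `[0, ∞]`). -/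
structure IsIntrinsic (G : WeightedGraph V) (ρ : V → V → ℝ) : Prop extends IsPseudoMetric ρ where
  sum_le : ∀ x, ∑' y, ENNReal.ofReal (G.weight x y * ρ x y ^ 2) ≤ ENNReal.ofReal (G.m x)

/-- The jump size `sup {ρ(x,y) | x ∼ y} ∈ [0, ∞]`. -/
def jumpSize (G : WeightedGraph V) (ρ : V → V → ℝ) : ℝ≥0∞ :=
  ⨆ (x : V) (y : V) (_ : 0 < G.weight x y), ENNReal.ofReal (ρ x y)

/-- `ρ(A,B) = inf {ρ(x,y) | x ∈ A, y ∈ B}`. -/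
def setDist (ρ : V → V → ℝ) (A B : Set V) : ℝ :=
  sInf {r | ∃ x ∈ A, ∃ y ∈ B, r = ρ x y}

/-- `ζ_s(t,r) = s⁻² (r s arsinh (r s / t) - √(t² + r² s²) + t)`. -/
def zeta (s t r : ℝ) : ℝ :=
  1 / s ^ 2 * (r * s * Real.arsinh (r * s / t) - √(t ^ 2 + r ^ 2 * s ^ 2) + t)

/-! ### The Hilbert space, the Dirichlet form and the Laplacian -/

/-- The energy `(1/2) ∑_{x,y} μ_{xy} |f(x) - f(y)|² ∈ [0, ∞]` of an arbitrary function. -/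
def energy (G : WeightedGraph V) (f : V → ℝ) : ℝ≥0∞ :=
  (1 / 2) * ∑' p : V × V, ENNReal.ofReal (G.weight p.1 p.2 * (f p.1 - f p.2) ^ 2)

/-- The bilinear form `(1/2) ∑_{x,y} μ_{xy} (f(x) - f(y)) (g(x) - g(y))`; the series converges
absolutely when `f` and `g` have finite energy. -/
def form (G : WeightedGraph V) (f g : V → ℝ) : ℝ :=
  (1 / 2) * ∑' p : V × V, G.weight p.1 p.2 * ((f p.1 - f p.2) * (g p.1 - g p.2))

variable [MeasurableSpace V]

/-- The measure `m` on `V`, that is `m(A) = ∑_{x ∈ A} m_x`. -/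
def vertexMeasure (G : WeightedGraph V) : Measure V :=
  Measure.sum fun x => ENNReal.ofReal (G.m x) • Measure.dirac x

/-- The real Hilbert space `ℓ²(V, m)`, with `⟪f, g⟫ = ∑_x f(x) g(x) m_x`. Since every vertex has
positive mass, each class contains exactly one function. -/
abbrev L2 (G : WeightedGraph V) : Type _ := Lp ℝ 2 G.vertexMeasure

/-- The domain of the Dirichlet form `Q`: the closure, with respect to the `ℓ²` norm together with the
energy, of the finitely supported functions. On this domain `Q` is given by `form`. -/
def formDomain (G : WeightedGraph V) : Set G.L2 :=
  {f | ∃ φ : ℕ → G.L2, (∀ n, (Function.support (φ n)).Finite) ∧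
    Tendsto φ atTop (𝓝 f) ∧
    Tendsto (fun n => G.energy fun x => φ n x - f x) atTop (𝓝 0)}

/-- The graph of the Laplacian `Δ`, the generator of the Dirichlet form `Q`: `f` belongs to the domain
of `Δ` and `Δ f = h` if and only if `f ∈ D(Q)` and `Q(f, g) = -⟪h, g⟫` for all `g ∈ D(Q)`. -/
def IsLaplacian (G : WeightedGraph V) (f h : G.L2) : Prop :=
  f ∈ G.formDomain ∧ ∀ g ∈ G.formDomain, G.form f g = -⟪h, g⟫

/-- The resolvent set of `-Δ`: the real `z` for which `-Δ - z` maps the domain of `Δ` bijectively onto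
`ℓ²` with a bounded inverse `R`. -/
def resolventSet (G : WeightedGraph V) : Set ℝ :=
  {z | ∃ R : G.L2 →L[ℝ] G.L2, ∀ f g : G.L2,
    R g = f ↔ ∃ h, G.IsLaplacian f h ∧ -h - z • f = g}

/-- The bottom `λ` of the `ℓ²`-spectrum of the Laplacian, i.e. the infimum of the spectrum of the
nonnegative self-adjoint operator `-Δ` (which is a subset of the real line). -/
def spectralBottom (G : WeightedGraph V) : ℝ := sInf (G.resolventSet)ᶜ

/-! ### The heat semigroup and the heat kernel -/

/-- `(1 - ε Δ)⁻¹ f` for `ε > 0`: the unique `u` in the domain of `Δ` with `u - ε Δ u = f`. -/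
def implicitStep (G : WeightedGraph V) (ε : ℝ) (f : G.L2) : G.L2 :=
  Classical.epsilon fun u => ∃ h, G.IsLaplacian u h ∧ u - ε • h = f

/-- The heat semigroup `e^{tΔ} f = lim_n (1 - (t/n) Δ)⁻ⁿ f` (limit in `ℓ²`) for `t > 0`, the
strongly continuous semigroup generated by `Δ`. -/
def heatSemigroup (G : WeightedGraph V) (t : ℝ) (f : G.L2) : G.L2 :=
  limUnder atTop fun n : ℕ => (G.implicitStep (t / n))^[n] f

variable [DiscreteMeasurableSpace V]

theorem vertexMeasure_singleton (G : WeightedGraph V) (x : V) :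
    G.vertexMeasure {x} = ENNReal.ofReal (G.m x) := by
  classical
  rw [vertexMeasure, Measure.sum_apply _ (measurableSet_singleton x), tsum_eq_single x]
  · simp
  · intro y hy
    simp [hy]

/-- The characteristic function `1_x` of a vertex, as an element of `ℓ²`. -/
def vertexIndicator (G : WeightedGraph V) (x : V) : G.L2 :=
  indicatorConstLp 2 (measurableSet_singleton x)
    ((G.vertexMeasure_singleton x).trans_ne ENNReal.ofReal_ne_top) (1 : ℝ)

/-- The minimal heat kernel, i.e. the integral kernel with respect to `m` of the semigroup
`e^{tΔ}` of the Dirichlet form `Q`: `p_t(x,y) = ⟪e^{tΔ} 1_x, 1_y⟫ / (m_x m_y)`. -/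
def heatKernel (G : WeightedGraph V) (t : ℝ) (x y : V) : ℝ :=
  ⟪G.heatSemigroup t (G.vertexIndicator x), G.vertexIndicator y⟫ / (G.m x * G.m y)

end

end WeightedGraph

/-! The proof is a weighted `ℓ²` estimate for the resolvent, iterated along the implicit Euler
scheme. Let `w` be `κ`-Lipschitz for `ρ` and bounded, `u = (1 - εΔ)⁻¹ f` and `v = e^w u`. Testing
the resolvent equation against `e^{2w} u` produces `Q(u, e^{2w} u)`. Edge by edge this equals the
energy density of `v` minus a term carrying the factor `cosh(w x - w y) - 1`
(`exp_sq_mul_identity`). On edges `ρ ≤ s`, hence `cosh(w x - w y) - 1 ≤ c ρ(x,y)²` with `c =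
(cosh(κs) - 1)/s²` (`cosh_sub_one_le`), and intrinsicness turns the error into `c‖v‖²`
(`form_expMul_two_mul_ge`). With `Q(v) ≥ λ‖v‖²` (`spectralBottom_mul_le`) this gives `(1 + ε(λ -
c))‖e^w u‖ ≤ ‖e^w f‖`.

Taking `ε = t/n`, iterating and letting `n → ∞` yields `⟪e^{tΔ} f, g⟫ ≤ e^{-λt + ct} ‖e^w f‖ ‖e^{-w}
g‖` (`inner_heatSemigroup_le`). For `w = κ min(ρ(·,A), ρ(A,B))`, `f` supported in `A` and `g` in
`B`, a gain `e^{-κ ρ(A,B)}` appears. The optimal `κ`, given by `sinh(κs) = ρ(A,B) s/t`, turns the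
exponent into `-λt - ζ_s`. Finite subsets of `A` and `B` are treated first, and the supremum over
them gives the theorem.

The objects must also be shown to exist: the resolvent is an orthogonal projection
(`exists_resolvent`, with positivity), and the Euler scheme converges on the domain of `Δ²` and then
by density (`exists_tendsto_euler`, `dense_sq_domain`). -/

namespace WeightedGraph

noncomputable section

set_option linter.unusedSectionVars false

section

/-! ### Elements of `ℓ²` as functions -/

/-- Singletons have positive mass, so null sets are empty; elements of `ℓ²` can be handled as honest
functions. -/
theorem eq_of_ae_eq {V : Type*} [MeasurableSpace V] [DiscreteMeasurableSpace V]
    {G : WeightedGraph V} {f g : V → ℝ} (h : f =ᵐ[G.vertexMeasure] g) : f = g := by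
  funext x
  by_contra hx
  have h0 : G.vertexMeasure {y | ¬ f y = g y} = 0 := ae_iff.1 h
  have h1 : G.vertexMeasure {x} ≤ 0 := by
    rw [← h0]
    exact measure_mono (by simpa using hx)
  rw [vertexMeasure_singleton] at h1
  have := G.m_pos x
  simp only [nonpos_iff_eq_zero, ENNReal.ofReal_eq_zero] at h1
  linarith

variable {V : Type*} [MeasurableSpace V] [DiscreteMeasurableSpace V] {G : WeightedGraph V}

theorem L2_ext {f g : G.L2} (h : ∀ x, f x = g x) : f = g :=
  Lp.ext (ae_of_all _ h)

theorem L2_add_apply (f g : G.L2) (x : V) : (f + g) x = f x + g x :=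
  congrFun (eq_of_ae_eq (Lp.coeFn_add f g)) x

theorem L2_sub_apply (f g : G.L2) (x : V) : (f - g) x = f x - g x :=
  congrFun (eq_of_ae_eq (Lp.coeFn_sub f g)) x

theorem L2_smul_apply (c : ℝ) (f : G.L2) (x : V) : (c • f) x = c * f x :=
  congrFun (eq_of_ae_eq (Lp.coeFn_smul c f)) x

theorem L2_zero_apply (x : V) : (0 : G.L2) x = 0 :=
  congrFun (eq_of_ae_eq (Lp.coeFn_zero ℝ 2 G.vertexMeasure)) x

theorem vertexIndicator_apply [DecidableEq V] (x y : V) :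
    G.vertexIndicator x y = if y = x then 1 else 0 := by
  have := congrFun (eq_of_ae_eq (indicatorConstLp_coeFn (μ := G.vertexMeasure) (p := 2)
    (hs := measurableSet_singleton x)
    (hμs := (G.vertexMeasure_singleton x).trans_ne ENNReal.ofReal_ne_top) (c := (1 : ℝ)))) y
  rw [vertexIndicator, this]
  simp [Set.indicator_apply]

theorem L2_sum_apply {ι : Type*} (S : Finset ι) (f : ι → G.L2) (x : V) :
    (∑ i ∈ S, f i) x = ∑ i ∈ S, f i x := by
  classical
  induction S using Finset.induction_on with
  | empty => rw [Finset.sum_empty, Finset.sum_empty, L2_zero_apply]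
  | insert a S ha ih => rw [Finset.sum_insert ha, Finset.sum_insert ha, L2_add_apply, ih]

/-- The characteristic function of a finite set of vertices. -/
def finsetIndicator (G : WeightedGraph V) (S : Finset V) : G.L2 := ∑ x ∈ S, G.vertexIndicator x

theorem finsetIndicator_apply [DecidableEq V] (S : Finset V) (y : V) :
    G.finsetIndicator S y = if y ∈ S then 1 else 0 := by
  rw [finsetIndicator, L2_sum_apply]
  simp [vertexIndicator_apply]

theorem aestronglyMeasurable_of_countable [Countable V] (f : V → ℝ) :
    AEStronglyMeasurable f G.vertexMeasure :=
  (Measurable.of_discrete (f := f)).aestronglyMeasurable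

open Classical in
/-- The element of `ℓ²` represented by a function, and zero if the function is not in `ℓ²`. -/
def ofFun (G : WeightedGraph V) (f : V → ℝ) : G.L2 :=
  if h : MemLp f 2 G.vertexMeasure then h.toLp f else 0

theorem ofFun_apply [Countable V] {f : V → ℝ} {g : G.L2} (C : ℝ)
    (h : ∀ x, |f x| ≤ C * |g x|) (x : V) : G.ofFun f x = f x := by
  have h1 : MemLp f 2 G.vertexMeasure :=
    MemLp.of_le_mul (Lp.memLp g) (aestronglyMeasurable_of_countable f) (ae_of_all _ h)
  rw [ofFun, dif_pos h1]
  exact congrFun (eq_of_ae_eq (h1.coeFn_toLp)) x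

theorem norm_le_of_le {f g : G.L2} {C : ℝ} (h : ∀ x, |f x| ≤ C * |g x|) : ‖f‖ ≤ C * ‖g‖ :=
  Lp.norm_le_mul_norm_of_ae_le_mul (ae_of_all _ h)

theorem hasSum_inner [Countable V] (f g : G.L2) :
    HasSum (fun x => G.m x * (f x * g x)) ⟪f, g⟫ := by
  have h := hasSum_integral_measure (L2.integrable_inner (𝕜 := ℝ) f g)
  rw [L2.inner_def]
  have h2 : (fun x => G.m x * (f x * g x)) = fun x => ∫ y, ⟪f y, g y⟫
      ∂(ENNReal.ofReal (G.m x) • Measure.dirac x) := by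
    funext x
    rw [integral_smul_measure, integral_dirac, ENNReal.toReal_ofReal (G.m_pos x).le]
    simp only [smul_eq_mul, RCLike.inner_apply, conj_trivial]
    ring
  rw [h2]
  exact h

theorem hasSum_norm_sq [Countable V] (f : G.L2) :
    HasSum (fun x => G.m x * f x ^ 2) (‖f‖ ^ 2) := by
  have h := hasSum_inner f f
  rw [real_inner_self_eq_norm_sq] at h
  simpa only [sq (f _)] using h

theorem apply_sq_le [Countable V] (f : G.L2) (x : V) : G.m x * f x ^ 2 ≤ ‖f‖ ^ 2 :=
  le_hasSum (hasSum_norm_sq f) x fun y _ => mul_nonneg (G.m_pos y).le (sq_nonneg _)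

/-- Evaluation at `x` is bounded on `ℓ²`, with constant `1 / √(m x)`. -/
theorem tendsto_apply [Countable V] {ι : Type*} {l : Filter ι} {φ : ι → G.L2} {f : G.L2}
    (h : Tendsto φ l (𝓝 f)) (x : V) : Tendsto (fun n => φ n x) l (𝓝 (f x)) := by
  rw [tendsto_iff_norm_sub_tendsto_zero] at h ⊢
  have hm := G.m_pos x
  refine squeeze_zero (fun _ => norm_nonneg _) (fun n => ?_)
    (by simpa using h.const_mul (1 / √(G.m x)))
  have h1 := apply_sq_le (φ n - f) x
  rw [L2_sub_apply] at h1
  rw [← div_eq_inv_mul, le_div_iff₀ (Real.sqrt_pos.2 hm), Real.norm_eq_abs]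
  refine abs_le_of_sq_le_sq' ?_ (norm_nonneg _) |>.2
  rw [mul_pow, Real.sq_sqrt hm.le, sq_abs]
  linarith

theorem inner_vertexIndicator [Countable V] (f : G.L2) (x : V) :
    ⟪f, G.vertexIndicator x⟫ = G.m x * f x := by
  classical
  refine (hasSum_inner f (G.vertexIndicator x)).unique ?_
  have := hasSum_ite_eq x (G.m x * f x)
  convert this using 2 with y
  rw [vertexIndicator_apply]
  split_ifs with h
  · simp [h]
  · simp

theorem norm_sq_finsetIndicator [Countable V] (S : Finset V) :
    ‖G.finsetIndicator S‖ ^ 2 = ∑ x ∈ S, G.m x := by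
  classical
  refine (hasSum_norm_sq (G.finsetIndicator S)).unique ?_
  have := hasSum_sum_of_ne_finset_zero (L := SummationFilter.unconditional V) (f := fun x => G.m x * G.finsetIndicator S x ^ 2) (s := S)
    (fun x hx => by simp [finsetIndicator_apply, hx])
  convert this using 1
  exact Finset.sum_congr rfl fun x hx => by simp [finsetIndicator_apply, hx]

end

section

/-! ### Finite energy functions and the form domain -/

/-- The functions of finite energy. -/
def FiniteEnergy {V : Type*} (G : WeightedGraph V) (f : V → ℝ) : Prop :=
  Summable fun p : V × V => G.weight p.1 p.2 * (f p.1 - f p.2) ^ 2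

section Energy

variable {V : Type*} {G : WeightedGraph V}

theorem weight_mul_sq_nonneg (f : V → ℝ) (p : V × V) :
    0 ≤ G.weight p.1 p.2 * (f p.1 - f p.2) ^ 2 :=
  mul_nonneg (G.weight_nonneg _ _) (sq_nonneg _)

theorem FiniteEnergy.summable_mul {f g : V → ℝ} (hf : G.FiniteEnergy f) (hg : G.FiniteEnergy g) :
    Summable fun p : V × V =>
      G.weight p.1 p.2 * ((f p.1 - f p.2) * (g p.1 - g p.2)) := by
  refine Summable.of_norm_bounded (Summable.add hf hg) fun p => ?_
  rw [Real.norm_eq_abs, abs_mul, abs_of_nonneg (G.weight_nonneg _ _), ← mul_add]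
  refine mul_le_mul_of_nonneg_left ?_ (G.weight_nonneg _ _)
  rw [abs_le]
  constructor <;> nlinarith [sq_nonneg (f p.1 - f p.2 + (g p.1 - g p.2)),
    sq_nonneg (f p.1 - f p.2 - (g p.1 - g p.2)), sq_nonneg (f p.1 - f p.2),
    sq_nonneg (g p.1 - g p.2)]

theorem FiniteEnergy.add {f g : V → ℝ} (hf : G.FiniteEnergy f) (hg : G.FiniteEnergy g) :
    G.FiniteEnergy fun x => f x + g x := by
  refine ((Summable.add hf hg).add ((hf.summable_mul hg).mul_left 2)).congr fun p => ?_
  ring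

theorem FiniteEnergy.smul {f : V → ℝ} (hf : G.FiniteEnergy f) (c : ℝ) :
    G.FiniteEnergy fun x => c * f x := by
  refine (Summable.mul_left (c ^ 2) hf).congr fun p => ?_
  ring

theorem FiniteEnergy.sub {f g : V → ℝ} (hf : G.FiniteEnergy f) (hg : G.FiniteEnergy g) :
    G.FiniteEnergy fun x => f x - g x := by
  simpa [sub_eq_add_neg] using hf.add (hg.smul (-1))

theorem form_add_left {f g h : V → ℝ} (hf : G.FiniteEnergy f) (hg : G.FiniteEnergy g)
    (hh : G.FiniteEnergy h) : G.form (fun x => f x + g x) h = G.form f h + G.form g h := by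
  rw [form, form, form, ← mul_add, ← (hf.summable_mul hh).tsum_add (hg.summable_mul hh)]
  congr 2
  funext p
  ring

theorem form_smul_left (c : ℝ) (f h : V → ℝ) :
    G.form (fun x => c * f x) h = c * G.form f h := by
  rw [form, form, mul_left_comm, ← tsum_mul_left (a := c)]
  congr 2
  funext p
  ring

theorem form_comm (f g : V → ℝ) : G.form f g = G.form g f := by
  rw [form, form]
  congr 2
  funext p
  ring

theorem form_sub_left {f g h : V → ℝ} (hf : G.FiniteEnergy f) (hg : G.FiniteEnergy g)
    (hh : G.FiniteEnergy h) : G.form (fun x => f x - g x) h = G.form f h - G.form g h := by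
  have := form_add_left hf (hg.smul (-1)) hh
  rw [form_smul_left] at this
  simpa [sub_eq_add_neg] using this

theorem form_self_nonneg (f : V → ℝ) : 0 ≤ G.form f f := by
  refine mul_nonneg (by norm_num) (tsum_nonneg fun p => ?_)
  have := weight_mul_sq_nonneg (G := G) f p
  rwa [sq] at this

theorem FiniteEnergy.energy_eq {f : V → ℝ} (hf : G.FiniteEnergy f) :
    G.energy f = ENNReal.ofReal (G.form f f) := by
  rw [energy, form, ENNReal.ofReal_mul (by norm_num), ENNReal.ofReal_tsum_of_nonneg]
  · congr 1
    · rw [ENNReal.ofReal_div_of_pos (by norm_num)]; simp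
    · simp only [sq]
  · intro p
    simpa [sq] using weight_mul_sq_nonneg (G := G) f p
  · simpa [sq, FiniteEnergy] using hf

theorem finiteEnergy_of_energy_ne_top {f : V → ℝ} (hf : G.energy f ≠ ⊤) : G.FiniteEnergy f := by
  have h : ∑' p : V × V, ENNReal.ofReal (G.weight p.1 p.2 * (f p.1 - f p.2) ^ 2) ≠ ⊤ := by
    intro h
    apply hf
    rw [energy, h, ENNReal.mul_top]
    simp
  refine (ENNReal.summable_toReal h).congr fun p => ?_
  exact (ENNReal.toReal_ofReal (weight_mul_sq_nonneg f p)).symm ▸ rfl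

theorem energy_add_le (f g : V → ℝ) :
    G.energy (fun x => f x + g x) ≤ 2 * G.energy f + 2 * G.energy g := by
  rw [energy, energy, energy, mul_left_comm, mul_left_comm 2, ← mul_add]
  refine mul_le_mul_right ?_ _
  rw [← ENNReal.tsum_mul_left, ← ENNReal.tsum_mul_left, ← ENNReal.tsum_add]
  refine ENNReal.tsum_le_tsum fun p => ?_
  have h2 : (2 : ℝ≥0∞) = ENNReal.ofReal 2 := by simp
  rw [h2, ← ENNReal.ofReal_mul zero_le_two, ← ENNReal.ofReal_mul zero_le_two,
    ← ENNReal.ofReal_add (mul_nonneg zero_le_two (weight_mul_sq_nonneg f p))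
      (mul_nonneg zero_le_two (weight_mul_sq_nonneg g p))]
  refine ENNReal.ofReal_le_ofReal ?_
  nlinarith [mul_nonneg (G.weight_nonneg p.1 p.2) (sq_nonneg ((f p.1 - f p.2) - (g p.1 - g p.2)))]

theorem energy_smul (c : ℝ) (f : V → ℝ) :
    G.energy (fun x => c * f x) = ENNReal.ofReal (c ^ 2) * G.energy f := by
  rw [energy, energy, mul_left_comm, ← ENNReal.tsum_mul_left (a := ENNReal.ofReal (c ^ 2))]
  congr 2
  funext p
  rw [← ENNReal.ofReal_mul (sq_nonneg c)]
  congr 1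
  ring

/-- By `(a - b)² ≤ 2a² + 2b²` it suffices that edge weights are summable at each of the finitely
many vertices of the support; symmetry of `μ` handles the second endpoint. -/
theorem finiteEnergy_of_finite_support {f : V → ℝ} (hf : (Function.support f).Finite) :
    G.FiniteEnergy f := by
  have h1 : Summable fun p : V × V => G.weight p.1 p.2 * f p.1 ^ 2 := by
    refine (summable_prod_of_nonneg
      (fun p : V × V => mul_nonneg (G.weight_nonneg p.1 p.2) (sq_nonneg (f p.1)))).2 ?_
    have h0 (x : V) : Summable fun y => G.weight x y * f x ^ 2 :=
      (G.weight_summable x).mul_right (f x ^ 2)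
    refine ⟨h0, ?_⟩
    refine summable_of_hasFiniteSupport (hf.subset fun x hx => ?_)
    contrapose! hx
    simp [Function.notMem_support.1 hx]
  have h2 : Summable fun p : V × V => G.weight p.1 p.2 * f p.2 ^ 2 := by
    rw [← (Equiv.prodComm V V).summable_iff]
    refine h1.congr fun p => ?_
    simp [G.weight_symm p.1 p.2]
  refine Summable.of_nonneg_of_le (weight_mul_sq_nonneg f) (fun p => ?_)
    ((h1.add h2).mul_left 2)
  nlinarith [mul_nonneg (G.weight_nonneg p.1 p.2) (sq_nonneg (f p.1 + f p.2))]

end Energy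

end

section

variable {V : Type*} [MeasurableSpace V] [DiscreteMeasurableSpace V] {G : WeightedGraph V}

/-! ### The form domain -/

theorem mem_formDomain_of_finite_support {f : G.L2} (hf : (Function.support f).Finite) :
    f ∈ G.formDomain :=
  ⟨fun _ => f, fun _ => hf, tendsto_const_nhds, by simp [energy]⟩

/-- Write `f = φ n - (φ n - f)` for one `n` at which the error has finite energy. -/
theorem finiteEnergy_of_mem_formDomain {f : G.L2} (hf : f ∈ G.formDomain) :
    G.FiniteEnergy f := by
  obtain ⟨φ, hφ, -, hE⟩ := hf
  obtain ⟨n, hn⟩ := (hE.eventually (gt_mem_nhds (ENNReal.zero_lt_top))).exists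
  have h := (finiteEnergy_of_finite_support (G := G) (hφ n)).sub
    (finiteEnergy_of_energy_ne_top hn.ne)
  simpa using h

theorem add_mem_formDomain {f g : G.L2} (hf : f ∈ G.formDomain) (hg : g ∈ G.formDomain) :
    f + g ∈ G.formDomain := by
  obtain ⟨φ, hφ, hφ1, hφ2⟩ := hf
  obtain ⟨ψ, hψ, hψ1, hψ2⟩ := hg
  refine ⟨fun n => φ n + ψ n, fun n => ?_, hφ1.add hψ1, ?_⟩
  · refine ((hφ n).union (hψ n)).subset fun x hx => ?_
    contrapose! hx
    simp only [Set.mem_union, Function.mem_support, not_or, not_not] at hx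
    rw [Function.notMem_support, L2_add_apply, hx.1, hx.2, add_zero]
  · have h := (ENNReal.Tendsto.const_mul hφ2 (Or.inr (ENNReal.ofNat_ne_top (n := 2)))).add
      (ENNReal.Tendsto.const_mul hψ2 (Or.inr (ENNReal.ofNat_ne_top (n := 2))))
    rw [mul_zero, add_zero] at h
    refine tendsto_of_tendsto_of_tendsto_of_le_of_le tendsto_const_nhds h (fun _ => zero_le)
      fun n => ?_
    refine le_trans (le_of_eq ?_) (energy_add_le (G := G) (fun x => φ n x - f x)
      (fun x => ψ n x - g x))
    congr 1
    funext x
    rw [L2_add_apply, L2_add_apply]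
    ring

theorem smul_mem_formDomain (c : ℝ) {f : G.L2} (hf : f ∈ G.formDomain) :
    c • f ∈ G.formDomain := by
  obtain ⟨φ, hφ, hφ1, hφ2⟩ := hf
  refine ⟨fun n => c • φ n, fun n => ?_, hφ1.const_smul c, ?_⟩
  · refine (hφ n).subset fun x hx => ?_
    contrapose! hx
    rw [Function.notMem_support] at hx
    simp [L2_smul_apply, hx]
  · have h := ENNReal.Tendsto.const_mul hφ2 (Or.inr (ENNReal.ofReal_ne_top (r := c ^ 2)))
    rw [mul_zero] at h
    refine h.congr fun n => ?_
    rw [← energy_smul]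
    congr 1
    funext x
    rw [L2_smul_apply, L2_smul_apply]
    ring

theorem sub_mem_formDomain {f g : G.L2} (hf : f ∈ G.formDomain) (hg : g ∈ G.formDomain) :
    f - g ∈ G.formDomain := by
  have := add_mem_formDomain hf (smul_mem_formDomain (-1) hg)
  rwa [neg_one_smul, ← sub_eq_add_neg] at this

theorem finite_support_vertexIndicator (x : V) :
    (Function.support (G.vertexIndicator x)).Finite := by
  classical
  refine (Set.finite_singleton x).subset fun y hy => ?_
  by_contra h
  simp only [Set.mem_singleton_iff] at h
  simp [vertexIndicator_apply, h] at hy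

theorem eq_zero_of_forall_inner_formDomain [Countable V] {h : G.L2}
    (H : ∀ g ∈ G.formDomain, ⟪h, g⟫ = 0) : h = 0 := by
  refine L2_ext fun x => ?_
  have h1 := H _ (mem_formDomain_of_finite_support (finite_support_vertexIndicator x))
  rw [inner_vertexIndicator] at h1
  rw [L2_zero_apply]
  exact (mul_eq_zero.1 h1).resolve_left (G.m_pos x).ne'

theorem form_L2_add_left {f g h : G.L2} (hf : f ∈ G.formDomain) (hg : g ∈ G.formDomain)
    (hh : h ∈ G.formDomain) : G.form (f + g : G.L2) h = G.form f h + G.form g h := by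
  rw [← form_add_left (finiteEnergy_of_mem_formDomain hf) (finiteEnergy_of_mem_formDomain hg)
    (finiteEnergy_of_mem_formDomain hh)]
  congr 1
  exact funext (L2_add_apply f g)

theorem form_L2_smul_left (c : ℝ) (f h : G.L2) :
    G.form (c • f : G.L2) h = c * G.form f h := by
  rw [← form_smul_left]
  congr 1
  exact funext (L2_smul_apply c f)

theorem form_L2_sub_left {f g h : G.L2} (hf : f ∈ G.formDomain) (hg : g ∈ G.formDomain)
    (hh : h ∈ G.formDomain) : G.form (f - g : G.L2) h = G.form f h - G.form g h := by
  rw [← form_sub_left (finiteEnergy_of_mem_formDomain hf) (finiteEnergy_of_mem_formDomain hg)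
    (finiteEnergy_of_mem_formDomain hh)]
  congr 1
  exact funext (L2_sub_apply f g)

/-! ### Intrinsic metrics and multiplication by bounded Lipschitz functions -/

theorem tsum_weight_mul_dist_sq_le [Countable V] {ρ : V → V → ℝ} (hρ : G.IsIntrinsic ρ)
    (f : G.L2) :
    ∑' p : V × V, ENNReal.ofReal (G.weight p.1 p.2 * ρ p.1 p.2 ^ 2 * f p.1 ^ 2) ≤
      ENNReal.ofReal (‖f‖ ^ 2) := by
  have h1 : ENNReal.ofReal (‖f‖ ^ 2) = ∑' x, ENNReal.ofReal (G.m x * f x ^ 2) := by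
    rw [← (hasSum_norm_sq f).tsum_eq, ENNReal.ofReal_tsum_of_nonneg
      (fun x => mul_nonneg (G.m_pos x).le (sq_nonneg _)) (hasSum_norm_sq f).summable]
  rw [h1, ENNReal.tsum_prod']
  refine ENNReal.tsum_le_tsum fun x => ?_
  rw [ENNReal.ofReal_mul (G.m_pos x).le]
  refine le_trans (le_of_eq ?_) (mul_le_mul_left (hρ.sum_le x) _)
  rw [← ENNReal.tsum_mul_right]
  congr 1
  funext y
  rw [← ENNReal.ofReal_mul (mul_nonneg (G.weight_nonneg _ _) (sq_nonneg _))]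

theorem hasSum_weight_mul_dist_sq [Countable V] {ρ : V → V → ℝ} (hρ : G.IsIntrinsic ρ)
    (f : G.L2) : ∃ a ≤ ‖f‖ ^ 2,
      HasSum (fun p : V × V => G.weight p.1 p.2 * ρ p.1 p.2 ^ 2 * f p.1 ^ 2) a := by
  have h := tsum_weight_mul_dist_sq_le hρ f
  have h0 (p : V × V) : 0 ≤ G.weight p.1 p.2 * ρ p.1 p.2 ^ 2 * f p.1 ^ 2 :=
    mul_nonneg (mul_nonneg (G.weight_nonneg _ _) (sq_nonneg _)) (sq_nonneg _)
  have hs : Summable fun p : V × V => G.weight p.1 p.2 * ρ p.1 p.2 ^ 2 * f p.1 ^ 2 := by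
    refine (ENNReal.summable_toReal (ne_top_of_le_ne_top ENNReal.ofReal_ne_top h)).congr
      fun p => ?_
    exact ENNReal.toReal_ofReal (h0 p)
  refine ⟨_, ?_, hs.hasSum⟩
  rw [← ENNReal.ofReal_tsum_of_nonneg h0 hs] at h
  exact (ENNReal.ofReal_le_ofReal_iff (sq_nonneg _)).1 h

/-- Leibniz rule `w x f x - w y f y = w y (f x - f y) + f x (w x - w y)`. The factor 2 from squaring
the sum cancels the `1/2` of the energy in the second term, which intrinsicness bounds by `‖f‖²`. -/
theorem energy_mul_le [Countable V] {ρ : V → V → ℝ} (hρ : G.IsIntrinsic ρ) {w : V → ℝ} {M L : ℝ}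
    (hM : ∀ x, |w x| ≤ M) (hL : ∀ x y, |w x - w y| ≤ L * ρ x y) (f : G.L2) :
    G.energy (fun x => w x * f x) ≤ ENNReal.ofReal (2 * M ^ 2) * G.energy f +
      ENNReal.ofReal (L ^ 2) * ENNReal.ofReal (‖f‖ ^ 2) := by
  refine le_trans ?_ (add_le_add_right (mul_le_mul_right (tsum_weight_mul_dist_sq_le hρ f) _) _)
  have hhalf : (1 / 2 : ℝ≥0∞) = ENNReal.ofReal (1 / 2) := by
    rw [ENNReal.ofReal_div_of_pos (by norm_num)]; simp
  rw [energy, energy, mul_left_comm, hhalf, ← ENNReal.tsum_mul_left, ← ENNReal.tsum_mul_left,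
    ← ENNReal.tsum_mul_left, ← ENNReal.tsum_mul_left, ← ENNReal.tsum_add]
  refine ENNReal.tsum_le_tsum fun p => ?_
  have hw := G.weight_nonneg p.1 p.2
  rw [← ENNReal.ofReal_mul (by norm_num), ← ENNReal.ofReal_mul (by positivity),
    ← ENNReal.ofReal_mul (by norm_num), ← ENNReal.ofReal_mul (by positivity),
    ← ENNReal.ofReal_add (by positivity) (by positivity)]
  refine ENNReal.ofReal_le_ofReal ?_
  have h1 : w p.2 ^ 2 ≤ M ^ 2 := sq_le_sq' (neg_le_of_abs_le (hM _)) (le_of_abs_le (hM _))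
  have h2 : (w p.1 - w p.2) ^ 2 ≤ (L * ρ p.1 p.2) ^ 2 :=
    sq_le_sq' (neg_le_of_abs_le (hL _ _)) (le_of_abs_le (hL _ _))
  have h3 : (w p.1 * f p.1 - w p.2 * f p.2) ^ 2 ≤
      2 * M ^ 2 * (f p.1 - f p.2) ^ 2 + 2 * (L * ρ p.1 p.2) ^ 2 * f p.1 ^ 2 := by
    nlinarith [sq_nonneg (w p.2 * (f p.1 - f p.2) - f p.1 * (w p.1 - w p.2)),
      mul_le_mul_of_nonneg_right h1 (sq_nonneg (f p.1 - f p.2)),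
      mul_le_mul_of_nonneg_right h2 (sq_nonneg (f p.1))]
  have h4 := mul_le_mul_of_nonneg_left h3 hw
  linarith

/-- If `φ n` approximates `f`, then `w φ n` approximates `w f`: supports do not grow, and
`energy_mul_le` controls the energy of `w (φ n - f)`. -/
theorem mul_mem_formDomain [Countable V] {ρ : V → V → ℝ} (hρ : G.IsIntrinsic ρ) {w : V → ℝ}
    {M L : ℝ} (hM : ∀ x, |w x| ≤ M) (hL : ∀ x y, |w x - w y| ≤ L * ρ x y) {f : G.L2}
    (hf : f ∈ G.formDomain) : G.ofFun (fun x => w x * f x) ∈ G.formDomain := by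
  have hap (g : G.L2) (x : V) : G.ofFun (fun x => w x * g x) x = w x * g x :=
    ofFun_apply M (g := g) (fun y => by
      rw [abs_mul]; exact mul_le_mul_of_nonneg_right (hM y) (abs_nonneg _)) x
  obtain ⟨φ, hφ, hφ1, hφ2⟩ := hf
  rw [tendsto_iff_norm_sub_tendsto_zero] at hφ1
  refine ⟨fun n => G.ofFun (fun x => w x * φ n x), fun n => ?_, ?_, ?_⟩
  · refine (hφ n).subset fun x hx => ?_
    contrapose! hx
    rw [Function.notMem_support] at hx
    simp [hap, hx]
  · rw [tendsto_iff_norm_sub_tendsto_zero]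
    refine squeeze_zero (fun _ => norm_nonneg _) (fun n => norm_le_of_le (C := M) fun x => ?_)
      (by simpa using hφ1.const_mul M)
    rw [L2_sub_apply, L2_sub_apply, hap, hap, ← mul_sub, abs_mul]
    exact mul_le_mul_of_nonneg_right (hM x) (abs_nonneg _)
  · have h1 : Tendsto (fun n => ENNReal.ofReal (2 * M ^ 2) * G.energy (fun x => φ n x - f x) +
        ENNReal.ofReal (L ^ 2) * ENNReal.ofReal (‖φ n - f‖ ^ 2)) atTop (𝓝 0) := by
      have h2 : Tendsto (fun n => ENNReal.ofReal (‖φ n - f‖ ^ 2)) atTop (𝓝 0) := by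
        have := ENNReal.tendsto_ofReal (hφ1.pow 2)
        simpa using this
      have := (ENNReal.Tendsto.const_mul hφ2 (Or.inr (ENNReal.ofReal_ne_top
        (r := 2 * M ^ 2)))).add (ENNReal.Tendsto.const_mul h2 (Or.inr (ENNReal.ofReal_ne_top
        (r := L ^ 2))))
      simpa using this
    refine tendsto_of_tendsto_of_tendsto_of_le_of_le tendsto_const_nhds h1 (fun _ => zero_le)
      fun n => ?_
    have h3 := energy_mul_le hρ hM hL (φ n - f)
    have h4 : (fun x => w x * (φ n - f : G.L2) x) = fun x =>
        G.ofFun (fun x => w x * φ n x) x - G.ofFun (fun x => w x * f x) x := by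
      funext x
      rw [hap, hap, L2_sub_apply]
      ring
    rw [h4] at h3
    rwa [funext (L2_sub_apply (φ n) f)] at h3

end

section

variable {V : Type*} [MeasurableSpace V] [DiscreteMeasurableSpace V] {G : WeightedGraph V}

/-! ### Existence and positivity of the resolvent -/

/-- The Hilbert space of pairs of a function on vertices and a function on pairs of vertices. -/
abbrev PairSpace (G : WeightedGraph V) : Type _ :=
  WithLp 2 (G.L2 × lp (fun _ : V × V => ℝ) 2)

/-- `b` is the gradient of `f`, with edge weights `ε μ / 2`. -/
def IsGradient (G : WeightedGraph V) (ε : ℝ) (f : V → ℝ) (b : lp (fun _ : V × V => ℝ) 2) : Prop :=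
  ∀ p : V × V, b p = √(ε * G.weight p.1 p.2 / 2) * (f p.1 - f p.2)

theorem IsGradient.hasSum {ε : ℝ} (hε : 0 < ε) {f g : V → ℝ} {b c : lp (fun _ : V × V => ℝ) 2}
    (hb : G.IsGradient ε f b) (hc : G.IsGradient ε g c) :
    HasSum (fun p : V × V => ε / 2 * (G.weight p.1 p.2 *
      ((f p.1 - f p.2) * (g p.1 - g p.2)))) ⟪b, c⟫ := by
  have h := lp.hasSum_inner (𝕜 := ℝ) b c
  have e : (fun p : V × V => ε / 2 * (G.weight p.1 p.2 *
      ((f p.1 - f p.2) * (g p.1 - g p.2)))) = fun p => ⟪b p, c p⟫ := by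
    funext p
    rw [hb p, hc p]
    have hw := G.weight_nonneg p.1 p.2
    have : √(ε * G.weight p.1 p.2 / 2) * √(ε * G.weight p.1 p.2 / 2) = ε * G.weight p.1 p.2 / 2 :=
      Real.mul_self_sqrt (by positivity)
    simp only [RCLike.inner_apply, conj_trivial]
    linear_combination (-((f p.1 - f p.2) * (g p.1 - g p.2))) * this
  rw [e]
  exact h

/-- The edge weight is chosen so that pairs of functions with their gradients have inner product
`⟪f, g⟫ + ε Q(f, g)`, the form of `1 - εΔ`. -/
theorem IsGradient.inner_eq {ε : ℝ} (hε : 0 < ε) {f g : V → ℝ} {b c : lp (fun _ : V × V => ℝ) 2}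
    (hb : G.IsGradient ε f b) (hc : G.IsGradient ε g c) : ⟪b, c⟫ = ε * G.form f g := by
  rw [← (hb.hasSum hε hc).tsum_eq, tsum_mul_left, form]
  ring

theorem IsGradient.finiteEnergy {ε : ℝ} (hε : 0 < ε) {f : V → ℝ}
    {b : lp (fun _ : V × V => ℝ) 2} (hb : G.IsGradient ε f b) : G.FiniteEnergy f := by
  refine ((hb.hasSum hε hb).summable.mul_left (2 / ε)).congr fun p => ?_
  field_simp

theorem IsGradient.sub {ε : ℝ} {f g : V → ℝ} {b c : lp (fun _ : V × V => ℝ) 2}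
    (hb : G.IsGradient ε f b) (hc : G.IsGradient ε g c) :
    G.IsGradient ε (fun x => f x - g x) (b - c) := by
  intro p
  rw [lp.coeFn_sub, Pi.sub_apply, hb p, hc p]
  ring

theorem exists_isGradient {ε : ℝ} (hε : 0 < ε) {f : V → ℝ} (hf : G.FiniteEnergy f) :
    ∃ b, G.IsGradient ε f b := by
  refine ⟨⟨fun p : V × V => √(ε * G.weight p.1 p.2 / 2) * (f p.1 - f p.2),
    memℓp_gen ?_⟩, fun p => rfl⟩
  refine (Summable.mul_left (ε / 2) hf).congr fun p => ?_
  have hw := G.weight_nonneg p.1 p.2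
  have h2 : (2 : ℝ≥0∞).toReal = ((2 : ℕ) : ℝ) := by simp
  rw [h2, Real.rpow_natCast, Real.norm_eq_abs, sq_abs, mul_pow, Real.sq_sqrt (by positivity)]
  ring

/-- The pairs of finitely supported functions and their gradients. -/
def gradientGraph (G : WeightedGraph V) (ε : ℝ) : Submodule ℝ G.PairSpace where
  carrier := {z | (Function.support z.fst).Finite ∧ G.IsGradient ε z.fst z.snd}
  add_mem' := by
    rintro z w ⟨hz, hz'⟩ ⟨hw, hw'⟩
    refine ⟨(hz.union hw).subset fun x hx => ?_, fun p => ?_⟩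
    · contrapose! hx
      simp only [Set.mem_union, Function.mem_support, not_or, not_not] at hx
      rw [Function.notMem_support, WithLp.add_fst, L2_add_apply, hx.1, hx.2, add_zero]
    · rw [WithLp.add_fst, WithLp.add_snd, lp.coeFn_add, Pi.add_apply, hz' p, hw' p, L2_add_apply,
        L2_add_apply]
      ring
  zero_mem' := by
    refine ⟨Set.Finite.subset Set.finite_empty fun x hx => absurd (L2_zero_apply x) hx,
      fun p => ?_⟩
    rw [WithLp.zero_fst, WithLp.zero_snd, lp.coeFn_zero, Pi.zero_apply, L2_zero_apply,
      L2_zero_apply]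
    ring
  smul_mem' := by
    rintro c z ⟨hz, hz'⟩
    refine ⟨hz.subset fun x hx => ?_, fun p => ?_⟩
    · contrapose! hx
      rw [Function.notMem_support] at hx
      rw [Function.notMem_support, WithLp.smul_fst, L2_smul_apply, hx, mul_zero]
    · rw [WithLp.smul_fst, WithLp.smul_snd, lp.coeFn_smul, Pi.smul_apply, hz' p, L2_smul_apply,
        L2_smul_apply, smul_eq_mul]
      ring

theorem tendsto_pair_iff {z : ℕ → G.PairSpace} {w : G.PairSpace} :
    Tendsto z atTop (𝓝 w) ↔ Tendsto (fun n => (z n).fst) atTop (𝓝 w.fst) ∧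
      Tendsto (fun n => (z n).snd) atTop (𝓝 w.snd) := by
  refine Iff.trans ?_ (Prod.tendsto_iff (fun n => WithLp.ofLp (z n)) (WithLp.ofLp w))
  constructor
  · intro h
    exact ((WithLp.prod_continuous_ofLp 2 _ _).tendsto w).comp h
  · intro h
    exact ((WithLp.prod_continuous_toLp 2 _ _).tendsto (WithLp.ofLp w)).comp h

/-- Point evaluations are continuous, so the gradient relation survives limits, and convergence of
gradients is convergence in energy. Together with `exists_mem_closure_gradientGraph`, the closure is
the graph of the gradient on `D(Q)`. -/
theorem mem_closure_gradientGraph [Countable V] {ε : ℝ} (hε : 0 < ε) {z : G.PairSpace}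
    (hz : z ∈ (G.gradientGraph ε).topologicalClosure) :
    z.fst ∈ G.formDomain ∧ G.IsGradient ε z.fst z.snd := by
  obtain ⟨w, hw, hwz⟩ := mem_closure_iff_seq_limit.1 hz
  obtain ⟨h1, h2⟩ := tendsto_pair_iff.1 hwz
  have hgrad : G.IsGradient ε z.fst z.snd := by
    intro p
    have h3 : Tendsto (fun n => (w n).snd p) atTop (𝓝 (z.snd p)) := by
      rw [tendsto_iff_norm_sub_tendsto_zero] at h2 ⊢
      exact squeeze_zero (fun _ => norm_nonneg _)
        (fun n => lp.norm_apply_le_norm two_ne_zero ((w n).snd - z.snd) p) h2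
    refine tendsto_nhds_unique h3 ?_
    refine Tendsto.congr (fun n => ((hw n).2 p).symm) ?_
    exact ((tendsto_apply h1 p.1).sub (tendsto_apply h1 p.2)).const_mul _
  refine ⟨⟨fun n => (w n).fst, fun n => (hw n).1, h1, ?_⟩, hgrad⟩
  have h4 (n : ℕ) : G.energy (fun x => (w n).fst x - z.fst x) =
      ENNReal.ofReal (1 / ε * ‖(w n).snd - z.snd‖ ^ 2) := by
    have h5 := (hw n).2.sub hgrad
    rw [(h5.finiteEnergy hε).energy_eq, ← real_inner_self_eq_norm_sq, h5.inner_eq hε h5]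
    congr 1
    field_simp
  simp_rw [h4]
  rw [tendsto_iff_norm_sub_tendsto_zero] at h2
  have := ENNReal.tendsto_ofReal ((h2.pow 2).const_mul (1 / ε))
  simpa using this

theorem exists_mem_closure_gradientGraph {ε : ℝ} (hε : 0 < ε) {g : G.L2}
    (hg : g ∈ G.formDomain) :
    ∃ z ∈ (G.gradientGraph ε).topologicalClosure, z.fst = g ∧ G.IsGradient ε g z.snd := by
  obtain ⟨b, hb⟩ := exists_isGradient hε (finiteEnergy_of_mem_formDomain hg)
  refine ⟨WithLp.toLp 2 (g, b), ?_, rfl, hb⟩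
  obtain ⟨φ, hφ, hφ1, hφ2⟩ := hg
  choose c hc using fun n => exists_isGradient hε (finiteEnergy_of_finite_support (G := G) (hφ n))
  refine mem_closure_iff_seq_limit.2 ⟨fun n => WithLp.toLp 2 (φ n, c n),
    fun n => ⟨hφ n, hc n⟩, tendsto_pair_iff.2 ⟨hφ1, ?_⟩⟩
  have h1 (n : ℕ) : ‖c n - b‖ ^ 2 = ε * (G.energy (fun x => φ n x - g x)).toReal := by
    have h5 := (hc n).sub hb
    rw [(h5.finiteEnergy hε).energy_eq, ← real_inner_self_eq_norm_sq, h5.inner_eq hε h5,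
      ENNReal.toReal_ofReal (form_self_nonneg _)]
  have h2 : Tendsto (fun n => ‖c n - b‖ ^ 2) atTop (𝓝 0) := by
    simp_rw [h1]
    have := ((ENNReal.tendsto_toReal ENNReal.zero_ne_top).comp hφ2).const_mul ε
    simpa using this
  rw [tendsto_iff_norm_sub_tendsto_zero]
  have h3 := h2.sqrt
  simpa using h3

/-- Project `F = (f, 0)` onto the closed gradient graph `K`. Orthogonality of `F - P` to `K` says
`⟪f - u, g⟫ = ε Q(u, g)`, the weak form of `u - εΔu = f`. For positivity, absolute values do not
increase the distance to `F` when `f ≥ 0`, so a sequence in the graph tending to `P` may be replaced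
by a nonnegative one. -/
theorem exists_resolvent [Countable V] {ε : ℝ} (hε : 0 < ε) (f : G.L2) :
    ∃ u h, G.IsLaplacian u h ∧ u - ε • h = f ∧ ((∀ x, 0 ≤ f x) → ∀ x, 0 ≤ u x) := by
  set K := (G.gradientGraph ε).topologicalClosure with hK
  have : CompleteSpace K := (Submodule.isClosed_topologicalClosure _).completeSpace_coe
  set F : G.PairSpace := WithLp.toLp 2 (f, 0) with hF
  set P : G.PairSpace := K.starProjection F with hP
  have hPK : P ∈ K := Submodule.starProjection_apply_mem K F
  obtain ⟨hu, hgrad⟩ := mem_closure_gradientGraph hε hPK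
  have horth (k : G.PairSpace) (hk : k ∈ K) : ⟪F - P, k⟫ = 0 :=
    Submodule.starProjection_inner_eq_zero F k hk
  refine ⟨P.fst, (1 / ε) • (P.fst - f), ⟨hu, fun g hg => ?_⟩, ?_, fun hf => ?_⟩
  · obtain ⟨z, hz, rfl, hz2⟩ := exists_mem_closure_gradientGraph hε hg
    have h1 := horth z hz
    rw [WithLp.prod_inner_apply] at h1
    have h2 : ⟪f - P.fst, z.fst⟫ + ⟪(0 : lp (fun _ : V × V => ℝ) 2) - P.snd, z.snd⟫ = 0 := h1
    rw [zero_sub, inner_neg_left, hgrad.inner_eq hε hz2] at h2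
    rw [real_inner_smul_left, ← neg_sub, inner_neg_left]
    field_simp
    linarith
  · rw [smul_smul, mul_one_div_cancel hε.ne', one_smul]
    abel
  · intro x
    obtain ⟨w, hw, hwP⟩ := mem_closure_iff_seq_limit.1 hPK
    have habs (n : ℕ) (x : V) : G.ofFun (fun x => |(w n).fst x|) x = |(w n).fst x| :=
      ofFun_apply 1 (g := (w n).fst) (fun y => by rw [abs_abs, one_mul]) x
    have hsupp (n : ℕ) : (Function.support (G.ofFun (fun x => |(w n).fst x|))).Finite := by
      refine (hw n).1.subset fun x hx => ?_
      contrapose! hx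
      rw [Function.notMem_support] at hx
      simp [habs, hx]
    choose c hc using fun n =>
      exists_isGradient hε (finiteEnergy_of_finite_support (G := G) (hsupp n))
    set v : ℕ → G.PairSpace := fun n => WithLp.toLp 2 (G.ofFun (fun x => |(w n).fst x|), c n)
    have hvK (n : ℕ) : v n ∈ K := subset_closure ⟨hsupp n, hc n⟩
    have hle (n : ℕ) : ‖v n - F‖ ^ 2 ≤ ‖w n - F‖ ^ 2 := by
      rw [WithLp.prod_norm_sq_eq_of_L2, WithLp.prod_norm_sq_eq_of_L2]
      have h1 : ‖G.ofFun (fun x => |(w n).fst x|) - f‖ ≤ 1 * ‖(w n).fst - f‖ := by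
        refine norm_le_of_le fun x => ?_
        rw [L2_sub_apply, L2_sub_apply, habs, one_mul]
        have h := abs_abs_sub_abs_le ((w n).fst x) (f x)
        rwa [abs_of_nonneg (hf x)] at h
      rw [one_mul] at h1
      have h2 : ‖c n‖ ^ 2 ≤ ‖(w n).snd‖ ^ 2 := by
        rw [← real_inner_self_eq_norm_sq, ← real_inner_self_eq_norm_sq]
        refine hasSum_le (fun p => ?_) ((hc n).hasSum hε (hc n)) ((hw n).2.hasSum hε (hw n).2)
        have hw0 := G.weight_nonneg p.1 p.2
        rw [habs, habs]
        have h3 := sq_le_sq.2 ((abs_abs_sub_abs_le ((w n).fst p.1) ((w n).fst p.2)))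
        rw [sq, sq] at h3
        gcongr
      have e1 : (v n - F).fst = G.ofFun (fun x => |(w n).fst x|) - f := rfl
      have e2 : (v n - F).snd = c n - 0 := rfl
      have e3 : (w n - F).fst = (w n).fst - f := rfl
      have e4 : (w n - F).snd = (w n).snd - 0 := rfl
      rw [e1, e2, e3, e4, sub_zero, sub_zero]
      gcongr
    -- Since `F - P` is orthogonal to `K`, comparing distances to `F` within `K` is the same as
    -- comparing distances to `P`.
    have hpyth (n : ℕ) : ‖v n - P‖ ^ 2 ≤ ‖w n - P‖ ^ 2 := by
      have hsplit (y : G.PairSpace) (hy : y ∈ K) :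
          ‖y - F‖ ^ 2 = ‖y - P‖ ^ 2 + ‖F - P‖ ^ 2 := by
        have e : y - F = (y - P) - (F - P) := by abel
        rw [e, norm_sub_sq_real, real_inner_comm, horth _ (K.sub_mem hy hPK)]
        ring
      have := hle n
      rw [hsplit _ (hvK n), hsplit _ (subset_closure (hw n))] at this
      linarith
    have hvP : Tendsto v atTop (𝓝 P) := by
      rw [tendsto_iff_norm_sub_tendsto_zero] at hwP ⊢
      exact squeeze_zero (fun _ => norm_nonneg _)
        (fun n => le_of_sq_le_sq (hpyth n) (norm_nonneg _)) hwP
    refine ge_of_tendsto' (tendsto_apply (tendsto_pair_iff.1 hvP).1 x) fun n => ?_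
    change 0 ≤ G.ofFun (fun x => |(w n).fst x|) x
    rw [habs]
    exact abs_nonneg _

end

section

/-! ### Convergence of the implicit Euler scheme -/

section Euler

variable {E : Type*} [NormedAddCommGroup E] [NormedSpace ℝ E]

theorem norm_pow_apply_le {T : E →L[ℝ] E} (hT : ∀ x, ‖T x‖ ≤ ‖x‖) (n : ℕ) (x : E) :
    ‖(T ^ n) x‖ ≤ ‖x‖ := by
  induction n with
  | zero => simp
  | succ n ih =>
    rw [pow_succ', mul_apply_eq_comp]
    exact (hT _).trans ih

theorem norm_pow_apply_sub_le {T : E →L[ℝ] E} (hT : ∀ x, ‖T x‖ ≤ ‖x‖) (n : ℕ) (x : E) :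
    ‖(T ^ n) x - x‖ ≤ n * ‖T x - x‖ := by
  induction n with
  | zero => simp
  | succ n ih =>
    have e : (T ^ (n + 1)) x - x = (T ^ n) (T x - x) + ((T ^ n) x - x) := by
      rw [pow_succ, mul_apply_eq_comp, map_sub]
      abel
    rw [e]
    have h1 := norm_pow_apply_le hT n (T x - x)
    rw [Nat.cast_succ]
    linarith [norm_add_le ((T ^ n) (T x - x)) ((T ^ n) x - x)]

/-- Telescoping: each of the `n` replacements of `T` by `S` costs at most `‖S x - T x‖`, as the
other factors are commuting contractions. -/
theorem norm_pow_sub_pow_apply_le {S T : E →L[ℝ] E} (hS : ∀ x, ‖S x‖ ≤ ‖x‖)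
    (hT : ∀ x, ‖T x‖ ≤ ‖x‖) (hST : Commute S T) (n : ℕ) (x : E) :
    ‖(S ^ n) x - (T ^ n) x‖ ≤ n * ‖S x - T x‖ := by
  induction n with
  | zero => simp
  | succ n ih =>
    have e : (S ^ (n + 1)) x - (T ^ (n + 1)) x =
        (S ^ n) (S x - T x) + T ((S ^ n) x - (T ^ n) x) := by
      have h1 : (S ^ n) (T x) = T ((S ^ n) x) := by
        rw [← mul_apply_eq_comp, (hST.pow_left n).eq, mul_apply_eq_comp]
      rw [pow_succ, pow_succ', mul_apply_eq_comp, mul_apply_eq_comp,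
        map_sub, map_sub, h1]
      abel
    rw [e]
    have h1 := norm_pow_apply_le hS n (S x - T x)
    have h2 := hT ((S ^ n) x - (T ^ n) x)
    rw [Nat.cast_succ]
    linarith [norm_add_le ((S ^ n) (S x - T x)) (T ((S ^ n) x - (T ^ n) x))]

variable {J : ℝ → E →L[ℝ] E} (hJ : ∀ ε > 0, ∀ x, ‖J ε x‖ ≤ ‖x‖)
  (hcomm : ∀ ε > 0, ∀ δ > 0, Commute (J ε) (J δ))

include hJ in
-- With `J ε = (1 + εA)⁻¹`, the hypotheses encode `f' = A f` and `f'' = A² f` without naming the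
-- unbounded `A`. One step of length `mh` and `m` steps of length `h` both agree with `f - mh f'` up
-- to `(mh)² ‖f''‖`.
theorem norm_resolvent_sub_pow_le {f f' f'' : E} (h1 : ∀ ε > 0, J ε f = f - ε • J ε f')
    (h2 : ∀ ε > 0, J ε f' = f' - ε • J ε f'') {h : ℝ} (hh : 0 < h) {m : ℕ} (hm : 0 < m) :
    ‖J (m * h) f - (J h ^ m) f‖ ≤ 2 * (m * h) ^ 2 * ‖f''‖ := by
  have hd (ε : ℝ) (hε : 0 < ε) : ‖J ε f' - f'‖ ≤ ε * ‖f''‖ := by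
    rw [h2 ε hε, sub_sub_cancel_left, norm_neg, norm_smul, Real.norm_of_nonneg hε.le]
    exact mul_le_mul_of_nonneg_left (hJ ε hε _) hε.le
  have ha (k : ℕ) : ‖(J h ^ k) f - f + (k * h) • f'‖ ≤ (k * h) ^ 2 * ‖f''‖ := by
    induction k with
    | zero => simp
    | succ k ih =>
      have e : (J h ^ (k + 1)) f - f + ((k + 1 : ℕ) * h) • f' =
          ((J h ^ k) f - f + (k * h) • f') - h • ((J h ^ (k + 1)) f' - f') := by
        have e1 : (J h ^ (k + 1)) f = (J h ^ k) f - h • (J h ^ (k + 1)) f' := by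
          rw [pow_succ, mul_apply_eq_comp, mul_apply_eq_comp]
          conv_lhs => rw [h1 h hh, map_sub, map_smul]
        rw [e1]
        push_cast
        module
      rw [e]
      refine (norm_sub_le _ _).trans ?_
      rw [norm_smul, Real.norm_of_nonneg hh.le]
      have h3 := (norm_pow_apply_sub_le (hJ h hh) (k + 1) f').trans
        (mul_le_mul_of_nonneg_left (hd h hh) (Nat.cast_nonneg _))
      have h4 := mul_le_mul_of_nonneg_left h3 hh.le
      -- This is the slack in `k² + (k + 1) ≤ (k + 1)²`.
      have h5 : 0 ≤ (k : ℝ) * h ^ 2 * ‖f''‖ := by positivity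
      rw [Nat.cast_succ] at h4 ⊢
      nlinarith
  have hmh : 0 < m * h := by positivity
  have hb : ‖J (m * h) f - f + (m * h) • f'‖ ≤ (m * h) ^ 2 * ‖f''‖ := by
    have e : J (m * h) f - f + (m * h) • f' = -((m * h) • (J (m * h) f' - f')) := by
      rw [h1 _ hmh]
      module
    rw [e, norm_neg, norm_smul, Real.norm_of_nonneg hmh.le, sq, mul_assoc (m * h)]
    exact mul_le_mul_of_nonneg_left (hd _ hmh) hmh.le
  have e : J (m * h) f - (J h ^ m) f =
      (J (m * h) f - f + (m * h) • f') - ((J h ^ m) f - f + (m * h) • f') := by abel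
  rw [e]
  linarith [norm_sub_le (J (m * h) f - f + (m * h) • f') ((J h ^ m) f - f + (m * h) • f'), ha m]

include hJ hcomm in
-- Refining each step of length `t/n` into `m` pieces costs `2(t/n)² ‖f''‖`, and there are `n`
-- steps.
theorem norm_euler_sub_euler_le {f f' f'' : E} (h1 : ∀ ε > 0, J ε f = f - ε • J ε f')
    (h2 : ∀ ε > 0, J ε f' = f' - ε • J ε f'') {t : ℝ} (ht : 0 < t) {n m : ℕ} (hn : 0 < n)
    (hm : 0 < m) :
    ‖(J (t / n) ^ n) f - (J (t / (m * n : ℕ)) ^ (m * n)) f‖ ≤ 2 * t ^ 2 * ‖f''‖ * (n : ℝ)⁻¹ := by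
  set h : ℝ := t / (m * n : ℕ)
  have hh : 0 < h := by positivity
  have e : t / n = m * h := by
    simp only [h]
    push_cast
    field_simp
  have htn : 0 < t / n := by positivity
  have h3 := norm_resolvent_sub_pow_le hJ h1 h2 hh hm
  have h4 := norm_pow_sub_pow_apply_le (hJ (t / n) htn) (norm_pow_apply_le (hJ h hh) m)
    ((hcomm (t / n) htn h hh).pow_right m) n f
  rw [← e] at h3
  rw [pow_mul]
  refine h4.trans ((mul_le_mul_of_nonneg_left h3 (Nat.cast_nonneg n)).trans_eq ?_)
  field_simp

include hJ hcomm in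
-- On the dense set, the `m`-step and `n`-step schemes are compared through their common refinement
-- with `mn` steps; contractivity carries the Cauchy property to all `f`.
theorem exists_tendsto_euler [CompleteSpace E]
    (hdense : Dense {f : E | ∃ f' f'', (∀ ε > 0, J ε f = f - ε • J ε f') ∧
      ∀ ε > 0, J ε f' = f' - ε • J ε f''}) {t : ℝ} (ht : 0 < t) (f : E) :
    ∃ g, Tendsto (fun n : ℕ => (J (t / n) ^ n) f) atTop (𝓝 g) := by
  refine cauchySeq_tendsto_of_complete (Metric.cauchySeq_iff.2 fun δ hδ => ?_)
  obtain ⟨g, hg, f', f'', h1, h2⟩ := Metric.dense_iff.1 hdense f (δ / 4) (by positivity)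
  rw [Metric.mem_ball, dist_eq_norm] at hg
  have h0 : Tendsto (fun n : ℕ => 2 * t ^ 2 * ‖f''‖ * (n : ℝ)⁻¹) atTop (𝓝 0) := by
    simpa using (tendsto_inv_atTop_nhds_zero_nat (𝕜 := ℝ)).const_mul (2 * t ^ 2 * ‖f''‖)
  obtain ⟨N, hN⟩ := eventually_atTop.1 (h0.eventually (gt_mem_nhds (show 0 < δ / 4 by positivity)))
  refine ⟨N + 1, fun m hm n hn => ?_⟩
  rw [dist_eq_norm]
  have hm0 : 0 < m := by omega
  have hn0 : 0 < n := by omega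
  have h3 := norm_euler_sub_euler_le hJ hcomm h1 h2 ht hn0 hm0
  have h4 := norm_euler_sub_euler_le hJ hcomm h1 h2 ht hm0 hn0
  rw [mul_comm n m] at h4
  have h5 := hN m (by omega)
  have h6 := hN n (by omega)
  have h7 (k : ℕ) (hk : 0 < k) : ‖(J (t / k) ^ k) (f - g)‖ ≤ ‖f - g‖ :=
    norm_pow_apply_le (hJ _ (by positivity)) k _
  rw [← norm_sub_rev] at hg
  have e : (J (t / m) ^ m) f - (J (t / n) ^ n) f =
      (J (t / m) ^ m) (f - g) - (J (t / n) ^ n) (f - g) +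
      (((J (t / m) ^ m) g - (J (t / (m * n : ℕ)) ^ (m * n)) g) -
      ((J (t / n) ^ n) g - (J (t / (m * n : ℕ)) ^ (m * n)) g)) := by
    rw [map_sub, map_sub]
    abel
  rw [e]
  refine (norm_add_le _ _).trans_lt ?_
  have h8 := norm_sub_le ((J (t / m) ^ m) (f - g)) ((J (t / n) ^ n) (f - g))
  have h9 := norm_sub_le ((J (t / m) ^ m) g - (J (t / (m * n : ℕ)) ^ (m * n)) g)
    ((J (t / n) ^ n) g - (J (t / (m * n : ℕ)) ^ (m * n)) g)
  linarith [h7 m hm0, h7 n hn0]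

end Euler

variable {V : Type*} [MeasurableSpace V] [DiscreteMeasurableSpace V] {G : WeightedGraph V}

/-! ### The Laplacian and the implicit Euler step -/

theorem IsLaplacian.add {f g h k : G.L2} (hf : G.IsLaplacian f h) (hg : G.IsLaplacian g k) :
    G.IsLaplacian (f + g) (h + k) := by
  refine ⟨add_mem_formDomain hf.1 hg.1, fun w hw => ?_⟩
  rw [form_L2_add_left hf.1 hg.1 hw, hf.2 w hw, hg.2 w hw, inner_add_left]
  ring

theorem IsLaplacian.smul {f h : G.L2} (c : ℝ) (hf : G.IsLaplacian f h) :
    G.IsLaplacian (c • f) (c • h) := by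
  refine ⟨smul_mem_formDomain c hf.1, fun w hw => ?_⟩
  rw [form_L2_smul_left, hf.2 w hw, real_inner_smul_left]
  ring

theorem IsLaplacian.sub {f g h k : G.L2} (hf : G.IsLaplacian f h) (hg : G.IsLaplacian g k) :
    G.IsLaplacian (f - g) (h - k) := by
  rw [sub_eq_add_neg f, ← neg_one_smul ℝ g, sub_eq_add_neg h, ← neg_one_smul ℝ k]
  exact hf.add (hg.smul (-1))

/-- Dissipativity: `-⟪h, f⟫ = Q(f, f) ≥ 0`, so `‖f‖² ≤ ⟪f - εh, f⟫`. -/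
theorem IsLaplacian.norm_le {ε : ℝ} (hε : 0 < ε) {f h : G.L2} (hf : G.IsLaplacian f h) :
    ‖f‖ ≤ ‖f - ε • h‖ := by
  have h1 := hf.2 f hf.1
  have h2 := form_self_nonneg (G := G) f
  have h3 : ‖f‖ ^ 2 ≤ ⟪f - ε • h, f⟫ := by
    rw [inner_sub_left, real_inner_smul_left, real_inner_self_eq_norm_sq]
    nlinarith
  have h4 := h3.trans (real_inner_le_norm _ _)
  rcases (norm_nonneg f).eq_or_lt with h0 | h0
  · rw [← h0]; exact norm_nonneg _
  · rw [sq] at h4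
    exact le_of_mul_le_mul_right h4 h0

theorem IsLaplacian.eq_of_sub_smul_eq {ε : ℝ} (hε : 0 < ε) {f g h k : G.L2}
    (hf : G.IsLaplacian f h) (hg : G.IsLaplacian g k) (e : f - ε • h = g - ε • k) : f = g := by
  have h1 := (hf.sub hg).norm_le hε
  have e2 : f - g - ε • (h - k) = 0 := by
    rw [smul_sub, sub_sub_sub_comm, e, sub_self]
  rw [e2, norm_zero] at h1
  exact sub_eq_zero.1 (norm_le_zero_iff.1 h1)

variable [Countable V]

theorem implicitStep_spec {ε : ℝ} (hε : 0 < ε) (f : G.L2) :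
    ∃ h, G.IsLaplacian (G.implicitStep ε f) h ∧ G.implicitStep ε f - ε • h = f := by
  obtain ⟨u, h, hu, he, -⟩ := exists_resolvent hε f
  exact Classical.epsilon_spec (p := fun u => ∃ h, G.IsLaplacian u h ∧ u - ε • h = f)
    ⟨u, h, hu, he⟩

theorem IsLaplacian.implicitStep_eq {ε : ℝ} (hε : 0 < ε) {f u h : G.L2} (hu : G.IsLaplacian u h)
    (e : u - ε • h = f) : G.implicitStep ε f = u := by
  obtain ⟨k, hk, hk2⟩ := implicitStep_spec hε f
  exact hk.eq_of_sub_smul_eq hε hu (hk2.trans e.symm)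

theorem implicitStep_nonneg {ε : ℝ} (hε : 0 < ε) {f : G.L2} (hf : ∀ x, 0 ≤ f x) (x : V) :
    0 ≤ G.implicitStep ε f x := by
  obtain ⟨u, h, hu, he, hpos⟩ := exists_resolvent hε f
  rw [hu.implicitStep_eq hε he]
  exact hpos hf x

theorem norm_implicitStep_le {ε : ℝ} (hε : 0 < ε) (f : G.L2) : ‖G.implicitStep ε f‖ ≤ ‖f‖ := by
  obtain ⟨k, hk, hk2⟩ := implicitStep_spec hε f
  have := hk.norm_le hε
  rwa [hk2] at this

/-- The operator `(1 - ε Δ)⁻¹` for `ε > 0`, and zero otherwise. -/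
def resolventOp (G : WeightedGraph V) (ε : ℝ) : G.L2 →L[ℝ] G.L2 :=
  if hε : 0 < ε then
    LinearMap.mkContinuous
      { toFun := G.implicitStep ε
        map_add' := fun f g => by
          obtain ⟨h, hh, hh2⟩ := implicitStep_spec hε f
          obtain ⟨k, hk, hk2⟩ := implicitStep_spec hε g
          refine (hh.add hk).implicitStep_eq hε ?_
          conv_rhs => rw [← hh2, ← hk2]
          module
        map_smul' := fun c f => by
          obtain ⟨h, hh, hh2⟩ := implicitStep_spec hε f
          refine (hh.smul c).implicitStep_eq hε ?_
          conv_rhs => rw [← hh2]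
          change c • _ - ε • c • h = c • _
          module }
      1 (fun f => by rw [one_mul]; exact norm_implicitStep_le hε f)
  else 0

theorem resolventOp_apply {ε : ℝ} (hε : 0 < ε) (f : G.L2) :
    G.resolventOp ε f = G.implicitStep ε f := by
  rw [resolventOp, dif_pos hε]
  rfl

theorem resolventOp_pow_apply {ε : ℝ} (hε : 0 < ε) (n : ℕ) (f : G.L2) :
    (G.resolventOp ε ^ n) f = (G.implicitStep ε)^[n] f := by
  induction n with
  | zero => rfl
  | succ n ih =>
    rw [pow_succ', mul_apply_eq_comp, ih, resolventOp_apply hε,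
      Function.iterate_succ_apply']

theorem IsLaplacian.resolventOp_eq {f h : G.L2} (hf : G.IsLaplacian f h) {ε : ℝ} (hε : 0 < ε) :
    G.resolventOp ε f = f + ε • G.resolventOp ε h := by
  have h1 : G.resolventOp ε (f - ε • h) = f := by
    rw [resolventOp_apply hε]
    exact hf.implicitStep_eq hε rfl
  rw [map_sub, map_smul] at h1
  rw [← sub_eq_iff_eq_add, h1]

theorem resolventOp_commute {ε δ : ℝ} (hε : 0 < ε) (hδ : 0 < δ) :
    Commute (G.resolventOp ε) (G.resolventOp δ) := by
  refine ContinuousLinearMap.ext fun f => ?_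
  rw [mul_apply_eq_comp, mul_apply_eq_comp]
  obtain ⟨h, hh, hh2⟩ := implicitStep_spec hδ f
  rw [← resolventOp_apply hδ] at hh hh2
  set w := G.resolventOp δ f
  obtain ⟨k, hk, hk2⟩ := implicitStep_spec hε w
  rw [← resolventOp_apply hε] at hk hk2
  set u := G.resolventOp ε w with hu
  have h1 := hh.resolventOp_eq hε
  rw [← hu] at h1
  -- The resolvent commutes with `Δ`: here `h = Δ w` and `k = Δ u`, where `u` is the resolvent of
  -- `w`.
  have h2 : G.resolventOp ε h = k := by
    have h3 : ε • (G.resolventOp ε h - k) = 0 := by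
      rw [smul_sub, sub_eq_zero]
      rw [← hk2] at h1
      have := sub_eq_iff_eq_add'.1 (sub_eq_zero.2 h1)
      have h4 : u = u + (ε • G.resolventOp ε h - ε • k) := by
        conv_lhs => rw [h1]
        abel
      exact sub_eq_zero.1 (left_eq_add.1 h4)
    exact sub_eq_zero.1 ((smul_eq_zero.1 h3).resolve_left hε.ne')
  rw [resolventOp_apply hδ]
  symm
  refine hk.implicitStep_eq hδ ?_
  rw [← hh2, map_sub, map_smul, h2]

theorem inner_resolventOp_left {ε : ℝ} (hε : 0 < ε) (f g : G.L2) :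
    ⟪G.resolventOp ε f, g⟫ = ⟪f, G.resolventOp ε g⟫ := by
  obtain ⟨h, hh, hh2⟩ := implicitStep_spec hε f
  obtain ⟨k, hk, hk2⟩ := implicitStep_spec hε g
  rw [← resolventOp_apply hε] at hh hh2 hk hk2
  have h1 := hh.2 _ hk.1
  have h2 := hk.2 _ hh.1
  rw [form_comm, h1] at h2
  conv_lhs => rw [← hk2]
  conv_rhs => rw [← hh2]
  rw [inner_sub_left, inner_sub_right, real_inner_smul_left, real_inner_smul_right]
  rw [real_inner_comm (G.resolventOp ε f) k] at h2
  linear_combination (-ε) * h2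

theorem resolventOp_injective {ε : ℝ} (hε : 0 < ε) {f : G.L2} (hf : G.resolventOp ε f = 0) :
    f = 0 := by
  obtain ⟨h, hh, hh2⟩ := implicitStep_spec hε f
  rw [← resolventOp_apply hε, hf] at hh hh2
  have h0 : h = 0 := eq_zero_of_forall_inner_formDomain fun g hg => by
    have h1 := hh.2 g hg
    have h2 := form_L2_smul_left (0 : ℝ) (0 : G.L2) g
    rw [smul_zero, zero_mul] at h2
    rw [h2] at h1
    linarith
  rw [← hh2, h0, smul_zero, sub_zero]

/-- The set contains the range of `K²`. As `K` is symmetric and injective, only `0` is orthogonal to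
that range. The witnesses are `f' = -Δf` and `f'' = Δ²f`. -/
theorem dense_sq_domain : Dense {f : G.L2 | ∃ f' f'',
    (∀ ε > 0, G.resolventOp ε f = f - ε • G.resolventOp ε f') ∧
      ∀ ε > 0, G.resolventOp ε f' = f' - ε • G.resolventOp ε f''} := by
  set K := G.resolventOp 1
  have hdense : Dense (LinearMap.range (K * K).toLinearMap : Set G.L2) := by
    rw [Submodule.dense_iff_topologicalClosure_eq_top, Submodule.topologicalClosure_eq_top_iff,
      Submodule.eq_bot_iff]
    intro g hg
    refine resolventOp_injective one_pos (resolventOp_injective one_pos ?_)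
    refine ext_inner_left ℝ fun f => ?_
    rw [inner_zero_right, ← inner_resolventOp_left one_pos, ← inner_resolventOp_left one_pos]
    exact (Submodule.mem_orthogonal _ _).1 hg _ ⟨f, rfl⟩
  refine hdense.mono ?_
  rintro _ ⟨f, rfl⟩
  obtain ⟨h, hh, hh2⟩ := implicitStep_spec one_pos (K f)
  obtain ⟨k, hk, hk2⟩ := implicitStep_spec one_pos f
  rw [← resolventOp_apply one_pos] at hh hh2 hk hk2
  have hKk : G.IsLaplacian h (h - k) := by
    have e1 : h = G.resolventOp 1 (K f) - K f := by
      rw [eq_sub_iff_add_eq']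
      conv_lhs => rw [← hh2]
      module
    have := hh.sub hk
    rwa [← e1] at this
  refine ⟨-h, h - k, fun ε hε => ?_, fun ε hε => ?_⟩
  · rw [map_neg, smul_neg, sub_neg_eq_add]
    exact hh.resolventOp_eq hε
  · rw [map_neg, hKk.resolventOp_eq hε]
    abel

theorem tendsto_heatSemigroup {t : ℝ} (ht : 0 < t) (f : G.L2) :
    Tendsto (fun n : ℕ => (G.resolventOp (t / n) ^ n) f) atTop (𝓝 (G.heatSemigroup t f)) := by
  have h := exists_tendsto_euler (J := G.resolventOp)
    (fun ε hε x => by rw [resolventOp_apply hε]; exact norm_implicitStep_le hε x)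
    (fun ε hε δ hδ => resolventOp_commute hε hδ) dense_sq_domain ht f
  have e : (fun n : ℕ => (G.resolventOp (t / n) ^ n) f) =
      fun n : ℕ => (G.implicitStep (t / n))^[n] f := by
    funext n
    -- At `n = 0` the step length `t / 0 = 0` is not positive, but both sides are zeroth powers,
    -- hence the identity.
    rcases n.eq_zero_or_pos with rfl | hn
    · rfl
    · exact resolventOp_pow_apply (by positivity) n f
  rw [e] at h ⊢
  exact tendsto_nhds_limUnder h

end

section

variable {V : Type*} [MeasurableSpace V] [DiscreteMeasurableSpace V] {G : WeightedGraph V}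

/-! ### The bottom of the spectrum and the quadratic form -/

/-- Put `q = Q - l‖·‖² ≥ 0`, so that `q(Ru, g) = ⟪u, g⟫`. Expanding `q(u - Ru/M) ≥ 0` and using
`⟪Ru, u⟫ ≤ M‖u‖²` gives `q(u) ≥ ‖u‖²/M`. -/
theorem form_self_gap_of_mem_resolventSet {l : ℝ}
    (hl : ∀ u ∈ G.formDomain, l * ‖u‖ ^ 2 ≤ G.form u u) (hres : l ∈ G.resolventSet) :
    ∃ δ > 0, ∀ u ∈ G.formDomain, (l + δ) * ‖u‖ ^ 2 ≤ G.form u u := by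
  obtain ⟨R, hR⟩ := hres
  set M := ‖R‖ + 1
  have hM : 0 < M := by positivity
  refine ⟨1 / M, by positivity, fun u hu => ?_⟩
  obtain ⟨h, hh, he⟩ := (hR (R u) u).1 rfl
  have hform (g : G.L2) (hg : g ∈ G.formDomain) :
      G.form (R u) g = ⟪u, g⟫ + l * ⟪R u, g⟫ := by
    rw [hh.2 g hg, ← inner_neg_left, sub_eq_iff_eq_add.1 he, inner_add_left,
      real_inner_smul_left]
  have hR1 := smul_mem_formDomain (1 / M) hh.1
  have hv := sub_mem_formDomain hu hR1
  have h1 := hl _ hv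
  have h2 : G.form (u - (1 / M) • R u : G.L2) (u - (1 / M) • R u : G.L2) =
      G.form u u - 2 * (1 / M) * G.form (R u) u + (1 / M) ^ 2 * G.form (R u) (R u) := by
    rw [form_L2_sub_left hu hR1 hv, form_comm u, form_L2_sub_left hu hR1 hu, form_L2_smul_left,
      form_L2_smul_left, form_comm (R u) (u - (1 / M) • R u : G.L2),
      form_L2_sub_left hu hR1 hh.1, form_L2_smul_left, form_comm u (R u)]
    ring
  rw [h2, hform u hu, hform _ hh.1, norm_sub_sq_real, real_inner_smul_right, norm_smul, mul_pow,
    real_inner_self_eq_norm_sq, real_inner_self_eq_norm_sq, real_inner_comm (R u) u,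
    Real.norm_of_nonneg (by positivity : 0 ≤ 1 / M)] at h1
  have h3 : ⟪R u, u⟫ ≤ M * ‖u‖ ^ 2 := by
    refine (real_inner_le_norm _ _).trans ?_
    have := R.le_opNorm u
    have h0 := norm_nonneg u
    simp only [M]
    nlinarith [mul_le_mul_of_nonneg_right this h0]
  have h4 := mul_le_mul_of_nonneg_left h3 (by positivity : 0 ≤ (1 / M) ^ 2)
  have h5 : (1 / M) ^ 2 * (M * ‖u‖ ^ 2) = 1 / M * ‖u‖ ^ 2 := by field_simp
  nlinarith

/-- The infimum of the Rayleigh quotients cannot lie in the resolvent set: the gap above would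
improve it. Hence it bounds `λ` from above, which is the only direction needed. -/
theorem spectralBottom_mul_le {u : G.L2} (hu : u ∈ G.formDomain) :
    G.spectralBottom * ‖u‖ ^ 2 ≤ G.form u u := by
  rcases eq_or_ne u 0 with rfl | hu0
  · rw [norm_zero]
    simpa using form_self_nonneg (G := G) (0 : G.L2)
  set S : Set ℝ := {r | ∃ v ∈ G.formDomain, v ≠ 0 ∧ r = G.form v v / ‖v‖ ^ 2}
  have hne : S.Nonempty := ⟨_, u, hu, hu0, rfl⟩
  have hS0 : ∀ r ∈ S, 0 ≤ r := by
    rintro _ ⟨v, -, -, rfl⟩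
    exact div_nonneg (form_self_nonneg _) (sq_nonneg _)
  have hbdd : BddBelow S := ⟨0, hS0⟩
  have hle : ∀ v ∈ G.formDomain, sInf S * ‖v‖ ^ 2 ≤ G.form v v := by
    intro v hv
    rcases eq_or_ne v 0 with rfl | hv0
    · rw [norm_zero]
      simpa using form_self_nonneg (G := G) (0 : G.L2)
    · have : 0 < ‖v‖ := norm_pos_iff.2 hv0
      rw [← le_div_iff₀ (by positivity)]
      exact csInf_le hbdd ⟨v, hv, hv0, rfl⟩
  have hspec : sInf S ∈ (G.resolventSet)ᶜ := by
    intro hres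
    obtain ⟨δ, hδ, hgap⟩ := form_self_gap_of_mem_resolventSet hle hres
    have : sInf S + δ ≤ sInf S := by
      refine le_csInf hne ?_
      rintro _ ⟨v, hv, hv0, rfl⟩
      have : 0 < ‖v‖ := norm_pos_iff.2 hv0
      rw [le_div_iff₀ (by positivity)]
      exact hgap v hv
    linarith
  have hbot : G.spectralBottom ≤ sInf S := by
    rw [spectralBottom]
    -- If the spectrum were unbounded below, `sInf` would be `0` by convention, which is still at
    -- most the nonnegative infimum.
    by_cases hb : BddBelow (G.resolventSet)ᶜ
    · exact csInf_le hb hspec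
    · rw [Real.sInf_of_not_bddBelow hb]
      exact Real.sInf_nonneg hS0
  exact (mul_le_mul_of_nonneg_right hbot (sq_nonneg _)).trans (hle u hu)

/-! ### Exponentially weighted estimates -/

/-- Compare power series termwise: `θ^(2n) ≤ θ²` for `n ≥ 1`, and the added `1 - θ²` at `n = 0`
balances the constant terms. -/
theorem cosh_mul_sub_one_le {θ b : ℝ} (h0 : 0 ≤ θ) (h1 : θ ≤ 1) :
    Real.cosh (θ * b) - 1 ≤ θ ^ 2 * (Real.cosh b - 1) := by
  have hs := (Real.hasSum_cosh b).mul_left (θ ^ 2)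
  have h := (hasSum_ite_eq (0 : ℕ) (1 - θ ^ 2)).add hs
  have := hasSum_le (fun n => ?_) (Real.hasSum_cosh (θ * b)) h
  · linarith
  · rcases n.eq_zero_or_pos with rfl | hn
    · simp
    · rw [if_neg hn.ne', zero_add, mul_pow, mul_div_assoc]
      refine mul_le_mul_of_nonneg_right (pow_le_pow_of_le_one h0 h1 (by omega)) ?_
      rw [pow_mul]
      positivity

/-- Apply `cosh_mul_sub_one_le` with `θ = d/s`; the jump size enters through `θ ≤ 1`. -/
theorem cosh_sub_one_le {s κ d x : ℝ} (hs : 0 < s) (hd : 0 ≤ d) (hds : d ≤ s)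
    (hx : |x| ≤ κ * d) : Real.cosh x - 1 ≤ (Real.cosh (κ * s) - 1) / s ^ 2 * d ^ 2 := by
  have h1 : Real.cosh x ≤ Real.cosh (κ * d) :=
    Real.cosh_le_cosh.2 (hx.trans (le_abs_self _))
  have h2 := cosh_mul_sub_one_le (θ := d / s) (b := κ * s) (by positivity)
    ((div_le_one hs).2 hds)
  have e : d / s * (κ * s) = κ * d := by field_simp
  rw [e] at h2
  calc Real.cosh x - 1 ≤ (d / s) ^ 2 * (Real.cosh (κ * s) - 1) := by linarith
    _ = _ := by field_simp

theorem dist_le_of_jumpSize {ρ : V → V → ℝ} {s : ℝ} (hs : 0 ≤ s)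
    (hjump : G.jumpSize ρ = ENNReal.ofReal s) {x y : V} (h : 0 < G.weight x y) : ρ x y ≤ s := by
  have h1 : ENNReal.ofReal (ρ x y) ≤ G.jumpSize ρ :=
    le_iSup_of_le x (le_iSup_of_le y (le_iSup_of_le h le_rfl))
  rw [hjump] at h1
  exact (ENNReal.ofReal_le_ofReal_iff hs).1 h1

theorem abs_exp_sub_exp_le {a b W : ℝ} (ha : a ≤ W) (hb : b ≤ W) :
    |Real.exp a - Real.exp b| ≤ Real.exp W * |a - b| := by
  wlog h : b ≤ a generalizing a b
  · rw [abs_sub_comm, abs_sub_comm a]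
    exact this hb ha (le_of_not_ge h)
  rw [abs_of_nonneg (sub_nonneg.2 (Real.exp_le_exp.2 h)), abs_of_nonneg (sub_nonneg.2 h)]
  have h1 : Real.exp b = Real.exp a * Real.exp (b - a) := by rw [← Real.exp_add]; ring_nf
  have h2 := Real.add_one_le_exp (b - a)
  have h3 := Real.exp_le_exp.2 ha
  have h4 := Real.exp_pos a
  rw [h1]
  nlinarith [mul_le_mul_of_nonneg_left h2 h4.le, mul_le_mul_of_nonneg_right h3 (sub_nonneg.2 h)]

variable [Countable V]

/-- The product of an element of `ℓ²` with the function `e^w`. -/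
def expMul (G : WeightedGraph V) (w : V → ℝ) (f : G.L2) : G.L2 :=
  G.ofFun fun x => Real.exp (w x) * f x

theorem expMul_apply {w : V → ℝ} {W : ℝ} (hW : ∀ x, w x ≤ W) (f : G.L2) (x : V) :
    G.expMul w f x = Real.exp (w x) * f x :=
  ofFun_apply (Real.exp W) (g := f) (fun y => by
    rw [abs_mul, Real.abs_exp]
    exact mul_le_mul_of_nonneg_right (Real.exp_le_exp.2 (hW y)) (abs_nonneg _)) x

theorem expMul_mem_formDomain {ρ : V → V → ℝ} (hρ : G.IsIntrinsic ρ) {w : V → ℝ} {W κ : ℝ}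
    (hW : ∀ x, w x ≤ W) (hw : ∀ x y, |w x - w y| ≤ κ * ρ x y) {f : G.L2}
    (hf : f ∈ G.formDomain) : G.expMul w f ∈ G.formDomain := by
  refine mul_mem_formDomain hρ (M := Real.exp W) (L := Real.exp W * κ) (fun x => ?_)
    (fun x y => ?_) hf
  · rw [Real.abs_exp]
    exact Real.exp_le_exp.2 (hW x)
  · refine (abs_exp_sub_exp_le (hW x) (hW y)).trans ?_
    rw [mul_assoc]
    exact mul_le_mul_of_nonneg_left (hw x y) (Real.exp_pos _).le

theorem inner_expMul_two_mul {w : V → ℝ} {W : ℝ} (hW : ∀ x, w x ≤ W) (f g : G.L2) :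
    ⟪f, G.expMul (fun x => 2 * w x) g⟫ = ⟪G.expMul w f, G.expMul w g⟫ := by
  refine (hasSum_inner _ _).unique ?_
  convert hasSum_inner (G.expMul w f) (G.expMul w g) using 2 with x
  rw [expMul_apply hW, expMul_apply hW,
    expMul_apply (w := fun x => 2 * w x) (W := 2 * W) (fun x => by linarith [hW x]), two_mul,
    Real.exp_add]
  ring

/-- Discrete counterpart of `∇u · ∇(e^{2w} u) = |∇(e^w u)|² - |∇w|² e^{2w} u²`; it rests on `e^{2a}
+ e^{2b} = 2 cosh(a - b) e^{a+b}`. -/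
theorem exp_sq_mul_identity (a b u v : ℝ) :
    (u - v) * (Real.exp (2 * a) * u - Real.exp (2 * b) * v) =
      (Real.exp a * u - Real.exp b * v) * (Real.exp a * u - Real.exp b * v) -
        2 * (Real.cosh (a - b) - 1) * ((Real.exp a * u) * (Real.exp b * v)) := by
  rw [Real.cosh_eq, neg_sub, Real.exp_sub, Real.exp_sub, two_mul, Real.exp_add, two_mul b,
    Real.exp_add]
  field_simp
  ring

/-- After `2 v x v y ≤ v x² + v y²`, the error splits into two sums, one per endpoint, each at most
`c‖v‖²`; the `1/2` in the form compensates for having two. -/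
theorem form_expMul_two_mul_ge {ρ : V → V → ℝ} (hρ : G.IsIntrinsic ρ) {s : ℝ} (hs : 0 < s)
    (hjump : G.jumpSize ρ = ENNReal.ofReal s) {w : V → ℝ} {W κ : ℝ}
    (hW : ∀ x, w x ≤ W) (hw : ∀ x y, |w x - w y| ≤ κ * ρ x y) {u : G.L2}
    (hu : u ∈ G.formDomain) :
    G.form (G.expMul w u) (G.expMul w u) -
        (Real.cosh (κ * s) - 1) / s ^ 2 * ‖G.expMul w u‖ ^ 2 ≤
      G.form u (G.expMul (fun x => 2 * w x) u) := by
  set c := (Real.cosh (κ * s) - 1) / s ^ 2 with hc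
  have hc0 : 0 ≤ c := div_nonneg (sub_nonneg.2 (Real.one_le_cosh _)) (sq_nonneg _)
  have hW2 : ∀ x, 2 * w x ≤ 2 * W := fun x => by linarith [hW x]
  set v := G.expMul w u with hv
  set z := G.expMul (fun x => 2 * w x) u with hz
  have hvD : v ∈ G.formDomain := expMul_mem_formDomain hρ hW hw hu
  have hzD : z ∈ G.formDomain := by
    refine expMul_mem_formDomain hρ (κ := 2 * κ) hW2 (fun x y => ?_) hu
    rw [← mul_sub, abs_mul, abs_two, mul_assoc]
    linarith [hw x y]
  obtain ⟨a, ha, hsum⟩ := hasSum_weight_mul_dist_sq hρ v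
  have hsum' : HasSum (fun p : V × V => G.weight p.1 p.2 * ρ p.1 p.2 ^ 2 * v p.2 ^ 2) a := by
    rw [← (Equiv.prodComm V V).hasSum_iff]
    convert hsum using 2 with p
    simp [G.weight_symm p.1 p.2, hρ.symm p.1 p.2]
  have hfv := (finiteEnergy_of_mem_formDomain hvD).summable_mul (finiteEnergy_of_mem_formDomain hvD)
  have hfz := (finiteEnergy_of_mem_formDomain hu).summable_mul (finiteEnergy_of_mem_formDomain hzD)
  have key := hasSum_le (fun p => ?_) (hfv.hasSum.sub ((hsum.add hsum').mul_left c)) hfz.hasSum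
  · rw [form, form]
    have := mul_le_mul_of_nonneg_left ha hc0
    linarith
  · have hμ := G.weight_nonneg p.1 p.2
    have e : (u p.1 - u p.2) * (z p.1 - z p.2) = (v p.1 - v p.2) * (v p.1 - v p.2) -
        2 * (Real.cosh (w p.1 - w p.2) - 1) * (v p.1 * v p.2) := by
      rw [hv, hz, expMul_apply hW, expMul_apply hW, expMul_apply (w := fun x => 2 * w x) hW2,
        expMul_apply (w := fun x => 2 * w x) hW2]
      exact exp_sq_mul_identity _ _ _ _
    rw [e]
    -- The bound `ρ ≤ s` holds only across edges; for pairs of weight zero every term vanishes.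
    rcases hμ.eq_or_lt with h0 | h0
    · rw [← h0]; simp
    have h1 := cosh_sub_one_le hs (hρ.nonneg p.1 p.2) (dist_le_of_jumpSize hs.le hjump h0)
      (hw p.1 p.2)
    have h2 : 0 ≤ Real.cosh (w p.1 - w p.2) - 1 := sub_nonneg.2 (Real.one_le_cosh _)
    have h3 : 2 * (Real.cosh (w p.1 - w p.2) - 1) * (v p.1 * v p.2) ≤
        c * ρ p.1 p.2 ^ 2 * (v p.1 ^ 2 + v p.2 ^ 2) := by
      have h4 : 2 * (v p.1 * v p.2) ≤ v p.1 ^ 2 + v p.2 ^ 2 := by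
        nlinarith [sq_nonneg (v p.1 - v p.2)]
      have h5 := mul_le_mul_of_nonneg_left h4 h2
      have h6 := mul_le_mul_of_nonneg_right h1 (add_nonneg (sq_nonneg (v p.1)) (sq_nonneg (v p.2)))
      linarith
    have h7 := mul_le_mul_of_nonneg_left h3 hμ
    linarith

/-- Pair `u - εΔu = f` with `e^{2w} u`, apply Cauchy–Schwarz to `⟪e^w f, e^w u⟫`, and divide by
`‖e^w u‖`. -/
theorem norm_expMul_resolventOp_le {ρ : V → V → ℝ} (hρ : G.IsIntrinsic ρ) {s : ℝ} (hs : 0 < s)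
    (hjump : G.jumpSize ρ = ENNReal.ofReal s) {w : V → ℝ} {W κ : ℝ}
    (hW : ∀ x, w x ≤ W) (hw : ∀ x y, |w x - w y| ≤ κ * ρ x y) {ε : ℝ} (hε : 0 < ε) (f : G.L2) :
    (1 + ε * (G.spectralBottom - (Real.cosh (κ * s) - 1) / s ^ 2)) *
      ‖G.expMul w (G.resolventOp ε f)‖ ≤ ‖G.expMul w f‖ := by
  obtain ⟨h, hh, he⟩ := implicitStep_spec hε f
  rw [← resolventOp_apply hε] at hh he
  set u := G.resolventOp ε f
  have hzD : G.expMul (fun x => 2 * w x) u ∈ G.formDomain := by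
    refine expMul_mem_formDomain hρ (κ := 2 * κ) (W := 2 * W) (fun x => by linarith [hW x])
      (fun x y => ?_) hh.1
    rw [← mul_sub, abs_mul, abs_two, mul_assoc]
    linarith [hw x y]
  have h1 := form_expMul_two_mul_ge hρ hs hjump hW hw hh.1
  have h2 := spectralBottom_mul_le (expMul_mem_formDomain hρ hW hw hh.1)
  have h3 := hh.2 _ hzD
  have h4 : ⟪f, G.expMul (fun x => 2 * w x) u⟫ = ‖G.expMul w u‖ ^ 2 +
      ε * G.form u (G.expMul (fun x => 2 * w x) u) := by
    conv_lhs => rw [← he]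
    rw [inner_sub_left, real_inner_smul_left, inner_expMul_two_mul hW, real_inner_self_eq_norm_sq,
      h3]
    ring
  rw [inner_expMul_two_mul hW] at h4
  have h5 := real_inner_le_norm (G.expMul w f) (G.expMul w u)
  have h6 := mul_le_mul_of_nonneg_left (h1.trans' (sub_le_sub_right h2 _)) hε.le
  rcases (norm_nonneg (G.expMul w u)).eq_or_lt with h0 | h0
  · rw [← h0, mul_zero]
    exact norm_nonneg _
  · refine le_of_mul_le_mul_right ?_ h0
    nlinarith

theorem norm_expMul_resolventOp_pow_le {ρ : V → V → ℝ} (hρ : G.IsIntrinsic ρ) {s : ℝ}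
    (hs : 0 < s) (hjump : G.jumpSize ρ = ENNReal.ofReal s) {w : V → ℝ} {W κ : ℝ}
    (hW : ∀ x, w x ≤ W) (hw : ∀ x y, |w x - w y| ≤ κ * ρ x y) {ε : ℝ} (hε : 0 < ε)
    (hpos : 0 ≤ 1 + ε * (G.spectralBottom - (Real.cosh (κ * s) - 1) / s ^ 2)) (n : ℕ)
    (f : G.L2) :
    (1 + ε * (G.spectralBottom - (Real.cosh (κ * s) - 1) / s ^ 2)) ^ n *
      ‖G.expMul w ((G.resolventOp ε ^ n) f)‖ ≤ ‖G.expMul w f‖ := by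
  induction n with
  | zero => simp
  | succ n ih =>
    have h1 := norm_expMul_resolventOp_le hρ hs hjump hW hw hε ((G.resolventOp ε ^ n) f)
    have h2 := mul_le_mul_of_nonneg_left h1 (pow_nonneg hpos n)
    rw [pow_succ, pow_succ' (G.resolventOp ε), mul_apply_eq_comp, mul_assoc]
    exact h2.trans ih

end

section

variable {V : Type*} [MeasurableSpace V] [DiscreteMeasurableSpace V] {G : WeightedGraph V}

/-! ### The Davies–Gaffney–Grigor'yan estimate -/

/-- The value `κ = arsinh(rs/t)/s` is the critical point of `κ ↦ t (cosh(κs) - 1)/s² - κr`. -/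
theorem neg_mul_add_eq_neg_zeta {s t r : ℝ} (hs : 0 < s) (ht : 0 < t) :
    t * ((Real.cosh (Real.arsinh (r * s / t) / s * s) - 1) / s ^ 2) -
      Real.arsinh (r * s / t) / s * r = -zeta s t r := by
  rw [div_mul_cancel₀ _ hs.ne', Real.cosh_arsinh, zeta]
  have h : √(t ^ 2 + r ^ 2 * s ^ 2) = t * √(1 + (r * s / t) ^ 2) := by
    have e : t ^ 2 + r ^ 2 * s ^ 2 = t ^ 2 * (1 + (r * s / t) ^ 2) := by field_simp
    rw [e, Real.sqrt_mul (sq_nonneg t), Real.sqrt_sq ht.le]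
  rw [h]
  field_simp
  ring

theorem setDist_nonneg {ρ : V → V → ℝ} (hρ : IsPseudoMetric ρ) (A B : Set V) :
    0 ≤ setDist ρ A B := by
  refine Real.sInf_nonneg ?_
  rintro _ ⟨x, -, y, -, rfl⟩
  exact hρ.nonneg x y

theorem setDist_le {ρ : V → V → ℝ} (hρ : IsPseudoMetric ρ) {A B : Set V} {x y : V} (hx : x ∈ A)
    (hy : y ∈ B) : setDist ρ A B ≤ ρ x y := by
  refine csInf_le ⟨0, ?_⟩ ⟨x, hx, y, hy, rfl⟩
  rintro _ ⟨x, -, y, -, rfl⟩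
  exact hρ.nonneg x y

/-- Take the distance to `A` truncated at `ρ(A,B)`. Truncation keeps `w` bounded, so that `e^{κw}`
acts on `ℓ²` even if `ρ` is unbounded. -/
theorem exists_cutoff {ρ : V → V → ℝ} (hρ : IsPseudoMetric ρ) {A : Set V} (hA : A.Nonempty)
    (B : Set V) : ∃ w : V → ℝ, (∀ x, 0 ≤ w x) ∧ (∀ x, w x ≤ setDist ρ A B) ∧
      (∀ x y, |w x - w y| ≤ ρ x y) ∧ (∀ x ∈ A, w x = 0) ∧ ∀ y ∈ B, w y = setDist ρ A B := by
  have : Nonempty A := hA.to_subtype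
  have hbdd (x : V) : BddBelow (Set.range fun a : A => ρ x a) := by
    refine ⟨0, ?_⟩
    rintro _ ⟨a, rfl⟩
    exact hρ.nonneg _ _
  have h0 (x : V) : 0 ≤ ⨅ a : A, ρ x a := le_ciInf fun a => hρ.nonneg _ _
  have htri (x y : V) : ⨅ a : A, ρ x a ≤ ρ x y + ⨅ a : A, ρ y a := by
    rw [← sub_le_iff_le_add']
    refine le_ciInf fun a => ?_
    rw [sub_le_iff_le_add']
    exact (ciInf_le (hbdd x) a).trans (hρ.triangle x y a)
  refine ⟨fun x => min (⨅ a : A, ρ x a) (setDist ρ A B),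
    fun x => le_min (h0 x) (setDist_nonneg hρ A B), fun x => min_le_right _ _, fun x y => ?_,
    fun x hx => ?_, fun y hy => ?_⟩
  · refine (abs_min_sub_min_le_max _ _ _ _).trans (max_le ?_ ?_)
    · rw [abs_le]
      have h1 := htri x y
      have h2 := htri y x
      rw [hρ.symm y x] at h2
      constructor <;> linarith
    · rw [sub_self, abs_zero]
      exact hρ.nonneg x y
  · have h1 : ⨅ a : A, ρ x a = 0 :=
      le_antisymm ((ciInf_le (hbdd x) ⟨x, hx⟩).trans_eq (hρ.diag x)) (h0 x)
    simp only [h1]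
    exact min_eq_left (setDist_nonneg hρ A B)
  · exact min_eq_right (le_ciInf fun a => (setDist_le hρ a.2 hy).trans_eq (hρ.symm _ _))

variable [Countable V]

/-- The weights `e^w` and `e^{-w}` cancel in the pairing, so the iterated resolvent bound applies to
the first factor. In the limit `(1 + tb/n)^n → e^{tb}` with `b = λ - c`. -/
theorem inner_heatSemigroup_le {ρ : V → V → ℝ} (hρ : G.IsIntrinsic ρ) {s : ℝ}
    (hs : 0 < s) (hjump : G.jumpSize ρ = ENNReal.ofReal s) {w : V → ℝ} {W κ : ℝ}
    (hW : ∀ x, |w x| ≤ W) (hw : ∀ x y, |w x - w y| ≤ κ * ρ x y) {t : ℝ} (ht : 0 < t)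
    (f g : G.L2) :
    ⟪G.heatSemigroup t f, g⟫ ≤
      Real.exp (-G.spectralBottom * t + t * ((Real.cosh (κ * s) - 1) / s ^ 2)) *
        (‖G.expMul w f‖ * ‖G.expMul (fun x => -w x) g‖) := by
  set b := G.spectralBottom - (Real.cosh (κ * s) - 1) / s ^ 2 with hb
  have hW1 (x : V) : w x ≤ W := le_of_abs_le (hW x)
  have hW2 (x : V) : -w x ≤ W := by linarith [neg_le_of_abs_le (hW x)]
  have hlim := ((Real.tendsto_one_add_div_pow_exp (t * b)).mul
    ((tendsto_heatSemigroup ht f).inner tendsto_const_nhds : Tendsto _ _ (𝓝 ⟪_, g⟫)))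
  have hbase : Tendsto (fun n : ℕ => 1 + t * b / n) atTop (𝓝 1) := by
    simpa using (tendsto_const_div_atTop_nhds_zero_nat (t * b)).const_add 1
  have hev : ∀ᶠ n : ℕ in atTop, (1 + t * b / n) ^ n * ⟪(G.resolventOp (t / n) ^ n) f, g⟫ ≤
      ‖G.expMul w f‖ * ‖G.expMul (fun x => -w x) g‖ := by
    -- `b` may be negative, so the base `1 + tb/n` is positive only for large `n`.
    filter_upwards [hbase.eventually (lt_mem_nhds one_pos), eventually_gt_atTop 0] with n hn hn0
    have e : t * b / n = t / n * b := by ring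
    rw [e] at hn ⊢
    have h1 := norm_expMul_resolventOp_pow_le hρ hs hjump hW1 hw
      (by positivity : 0 < t / n) hn.le n f
    have h2 : ⟪(G.resolventOp (t / n) ^ n) f, g⟫ =
        ⟪G.expMul w ((G.resolventOp (t / n) ^ n) f), G.expMul (fun x => -w x) g⟫ := by
      refine (hasSum_inner _ _).unique ?_
      convert hasSum_inner (G.expMul w ((G.resolventOp (t / n) ^ n) f))
        (G.expMul (fun x => -w x) g) using 2 with x
      rw [expMul_apply hW1, expMul_apply (w := fun x => -w x) hW2, Real.exp_neg]
      field_simp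
    have h3 := real_inner_le_norm (G.expMul w ((G.resolventOp (t / n) ^ n) f))
      (G.expMul (fun x => -w x) g)
    rw [← h2] at h3
    refine (mul_le_mul_of_nonneg_left h3 (pow_nonneg hn.le n)).trans ?_
    rw [← mul_assoc]
    exact mul_le_mul_of_nonneg_right h1 (norm_nonneg _)
  have h4 := le_of_tendsto hlim hev
  have h5 : -G.spectralBottom * t + t * ((Real.cosh (κ * s) - 1) / s ^ 2) = -(t * b) := by
    rw [hb]; ring
  rw [h5, Real.exp_neg, ← div_eq_inv_mul, le_div_iff₀ (Real.exp_pos _), mul_comm]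
  exact h4

/-- The cutoff is built from `A` and `B`, not from `S` and `T`, so the exponent does not depend on
the finite subsets. -/
theorem inner_heatSemigroup_finsetIndicator_le {ρ : V → V → ℝ} (hρ : G.IsIntrinsic ρ) {s : ℝ}
    (hs : 0 < s) (hjump : G.jumpSize ρ = ENNReal.ofReal s) {A B : Set V} (hA : A.Nonempty)
    {t : ℝ} (ht : 0 < t) {S T : Finset V} (hS : (S : Set V) ⊆ A) (hT : (T : Set V) ⊆ B) :
    ⟪G.heatSemigroup t (G.finsetIndicator S), G.finsetIndicator T⟫ ≤
      ‖G.finsetIndicator S‖ * ‖G.finsetIndicator T‖ *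
        Real.exp (-G.spectralBottom * t - zeta s t (setDist ρ A B)) := by
  classical
  set r := setDist ρ A B
  have hr : 0 ≤ r := setDist_nonneg hρ.toIsPseudoMetric A B
  set κ := Real.arsinh (r * s / t) / s
  have hκ : 0 ≤ κ := div_nonneg (Real.arsinh_nonneg_iff.2 (by positivity)) hs.le
  obtain ⟨w, hw0, hwr, hw, hwA, hwB⟩ := exists_cutoff hρ.toIsPseudoMetric hA B
  have hW (x : V) : |κ * w x| ≤ κ * r := by
    rw [abs_of_nonneg (mul_nonneg hκ (hw0 x))]
    exact mul_le_mul_of_nonneg_left (hwr x) hκ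
  have h1 := inner_heatSemigroup_le hρ hs hjump (w := fun x => κ * w x) hW (fun x y => by
    rw [← mul_sub, abs_mul, abs_of_nonneg hκ]
    exact mul_le_mul_of_nonneg_left (hw x y) hκ) ht (G.finsetIndicator S) (G.finsetIndicator T)
  have h2 : ‖G.expMul (fun x => κ * w x) (G.finsetIndicator S)‖ ≤ 1 * ‖G.finsetIndicator S‖ := by
    refine norm_le_of_le fun x => ?_
    rw [expMul_apply (w := fun x => κ * w x) (fun x => le_of_abs_le (hW x)),
      finsetIndicator_apply]
    split_ifs with hx
    · simp [hwA x (hS hx)]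
    · simp
  have h3 : ‖G.expMul (fun x => -(κ * w x)) (G.finsetIndicator T)‖ ≤
      Real.exp (-(κ * r)) * ‖G.finsetIndicator T‖ := by
    refine norm_le_of_le fun x => ?_
    rw [expMul_apply (w := fun x => -(κ * w x)) (W := κ * r)
      (fun x => by linarith [neg_le_of_abs_le (hW x)]), finsetIndicator_apply]
    split_ifs with hx
    · rw [hwB x (hT hx)]
      simp [r]
    · simp
  rw [one_mul] at h2
  have h4 : -G.spectralBottom * t - zeta s t r =
      (-G.spectralBottom * t + t * ((Real.cosh (κ * s) - 1) / s ^ 2)) + -(κ * r) := by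
    rw [sub_eq_add_neg, ← neg_mul_add_eq_neg_zeta hs ht]
    ring
  refine h1.trans ((mul_le_mul_of_nonneg_left (mul_le_mul h2 h3 (norm_nonneg _) (norm_nonneg _))
    (Real.exp_pos _).le).trans_eq ?_)
  rw [h4, Real.exp_add _ (-(κ * r))]
  ring

/-! ### From finite sets to the heat kernel sums -/

theorem heatSemigroup_finsetIndicator {t : ℝ} (ht : 0 < t) (S : Finset V) :
    G.heatSemigroup t (G.finsetIndicator S) =
      ∑ x ∈ S, G.heatSemigroup t (G.vertexIndicator x) := by
  refine tendsto_nhds_unique (tendsto_heatSemigroup ht _) ?_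
  refine (tendsto_finsetSum S fun x _ => tendsto_heatSemigroup ht (G.vertexIndicator x)).congr
    fun n => ?_
  rw [finsetIndicator, map_sum]

theorem heatSemigroup_nonneg {t : ℝ} (ht : 0 < t) {f : G.L2} (hf : ∀ x, 0 ≤ f x) (x : V) :
    0 ≤ G.heatSemigroup t f x := by
  refine ge_of_tendsto (tendsto_apply (tendsto_heatSemigroup ht f) x) ?_
  filter_upwards [eventually_gt_atTop 0] with n hn
  have hε : 0 < t / n := by positivity
  have h (k : ℕ) : ∀ x, 0 ≤ (G.resolventOp (t / n) ^ k) f x := by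
    induction k with
    | zero => exact hf
    | succ k ih =>
      rw [pow_succ', mul_apply_eq_comp, resolventOp_apply hε]
      exact implicitStep_nonneg hε ih
  exact h n x

theorem mul_heatKernel (t : ℝ) (x y : V) : G.m x * G.m y * G.heatKernel t x y =
    ⟪G.heatSemigroup t (G.vertexIndicator x), G.vertexIndicator y⟫ := by
  have hx := (G.m_pos x).ne'
  have hy := (G.m_pos y).ne'
  rw [heatKernel]
  field_simp

theorem inner_heatSemigroup_vertexIndicator_nonneg {t : ℝ} (ht : 0 < t) (x y : V) :
    0 ≤ ⟪G.heatSemigroup t (G.vertexIndicator x), G.vertexIndicator y⟫ := by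
  classical
  rw [inner_vertexIndicator]
  refine mul_nonneg (G.m_pos y).le (heatSemigroup_nonneg ht (fun z => ?_) y)
  rw [vertexIndicator_apply]
  split_ifs <;> norm_num

theorem ofReal_norm_finsetIndicator (S : Finset V) :
    ENNReal.ofReal ‖G.finsetIndicator S‖ = G.vertexMeasure S ^ (1 / 2 : ℝ) := by
  have h : G.vertexMeasure S = ENNReal.ofReal (‖G.finsetIndicator S‖ ^ 2) := by
    rw [norm_sq_finsetIndicator, ENNReal.ofReal_sum_of_nonneg fun x _ => (G.m_pos x).le,
      ← sum_measure_singleton]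
    exact Finset.sum_congr rfl fun x _ => G.vertexMeasure_singleton x
  rw [h, ENNReal.ofReal_rpow_of_nonneg (sq_nonneg _) (by norm_num), ← Real.sqrt_eq_rpow,
    Real.sqrt_sq (norm_nonneg _)]

/-- Nonnegativity of the kernel lets `ENNReal.ofReal` pass through the sums; monotonicity of the
measure then allows infinite `m(A)` or `m(B)`. -/
theorem sum_heatKernel_le {ρ : V → V → ℝ} (hρ : G.IsIntrinsic ρ) {s : ℝ}
    (hs : 0 < s) (hjump : G.jumpSize ρ = ENNReal.ofReal s) {A B : Set V} (hA : A.Nonempty)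
    {t : ℝ} (ht : 0 < t) {S T : Finset V} (hS : (S : Set V) ⊆ A) (hT : (T : Set V) ⊆ B) :
    ∑ y ∈ T, ∑ x ∈ S, ENNReal.ofReal (G.m x * G.m y * G.heatKernel t x y) ≤
      (G.vertexMeasure A * G.vertexMeasure B) ^ (1 / 2 : ℝ) *
        ENNReal.ofReal (Real.exp (-G.spectralBottom * t - zeta s t (setDist ρ A B))) := by
  have h1 : ∑ y ∈ T, ∑ x ∈ S, ENNReal.ofReal (G.m x * G.m y * G.heatKernel t x y) =
      ENNReal.ofReal ⟪G.heatSemigroup t (G.finsetIndicator S), G.finsetIndicator T⟫ := by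
    rw [heatSemigroup_finsetIndicator ht, finsetIndicator, inner_sum,
      ENNReal.ofReal_sum_of_nonneg]
    · refine Finset.sum_congr rfl fun y _ => ?_
      rw [sum_inner, ENNReal.ofReal_sum_of_nonneg]
      · exact Finset.sum_congr rfl fun x _ => by rw [mul_heatKernel]
      · exact fun x _ => inner_heatSemigroup_vertexIndicator_nonneg ht x y
    · intro y _
      rw [sum_inner]
      exact Finset.sum_nonneg fun x _ => inner_heatSemigroup_vertexIndicator_nonneg ht x y
  rw [h1]
  refine (ENNReal.ofReal_le_ofReal
    (inner_heatSemigroup_finsetIndicator_le hρ hs hjump hA ht hS hT)).trans ?_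
  rw [ENNReal.ofReal_mul (by positivity), ENNReal.ofReal_mul (norm_nonneg _),
    ofReal_norm_finsetIndicator, ofReal_norm_finsetIndicator,
    ← ENNReal.mul_rpow_of_nonneg _ _ (by norm_num : (0 : ℝ) ≤ 1 / 2)]
  gcongr

end

end

end WeightedGraph

theorem mainTheorem2 {V : Type*} [Countable V] [MeasurableSpace V] [DiscreteMeasurableSpace V]
    (G : WeightedGraph V) (ρ : V → V → ℝ) (hρ : G.IsIntrinsic ρ)
    (s : ℝ) (hs : 0 < s) (hjump : G.jumpSize ρ = ENNReal.ofReal s)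
    (A B : Set V) (t : ℝ) (ht : 0 < t) :
    ∑' y : B, ∑' x : A, ENNReal.ofReal (G.m x * G.m y * G.heatKernel t x y) ≤
      (G.vertexMeasure A * G.vertexMeasure B) ^ (1 / 2 : ℝ) *
        ENNReal.ofReal (Real.exp (-G.spectralBottom * t -
          WeightedGraph.zeta s t (WeightedGraph.setDist ρ A B))) := by
  -- The cutoff needs `A` nonempty. An empty `B` needs no separate case, and both series are suprema
  -- of finite sums.
  rcases A.eq_empty_or_nonempty with rfl | hA
  · simp
  rw [ENNReal.tsum_eq_iSup_sum]
  refine iSup_le fun T => ?_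
  rw [← Summable.tsum_finsetSum fun _ _ => ENNReal.summable, ENNReal.tsum_eq_iSup_sum]
  refine iSup_le fun S => ?_
  rw [Finset.sum_comm]
  have h := WeightedGraph.sum_heatKernel_le hρ hs hjump hA ht
    (S := S.map (Function.Embedding.subtype _)) (T := T.map (Function.Embedding.subtype _))
    (A := A) (B := B) (by intro x; simp +contextual) (by intro x; simp +contextual)
  simpa using h
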